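/- Consider asynchronous shared memory systems of $n$ processes $p_1,\dots,p_n$. A (deterministic) data type $T$ has a set of states, a set of possible initial states, a set of invocations, a set of return values, and a transition map $\delta$ taking a state and an invocation to a return value and a new state. For a nonempty set $V$ of values, a fetch-and-cons (FAC) object stores a list over $V$, initially empty; $\mathrm{fac}(v)$ adds $v$ to the head of the list and returns the whole list stored before. A read/write register over a set $X$ stores an element of $X$, which can be read and overwritten. A history is a finite or infinite sequence of invocation and response events. It is well-formed if for each process $p$ its subsequence of events of $p$ starts with an invocation and each invocation, except possibly the last event, is immediately followed by a response, and each response is immediately preceded by an invocation. A sequential history is legal if it obeys the specification of $T$, started in a possible initial state. A well-formed history $H$ is weakly consistent if for each operation $o$ by a process $p$ that returns in $H$ there is a legal sequential history that contains only operations invoked in $H$ before $o$ returns, contains all operations of $p$ that precede $o$, and ends with $o$ having the same response as in $H$. For $t\ge 0$ let $H_t$ be $H$ without its first $t$ events. A $t$-linearization of $H$ is a legal sequential history $H_S$ such that every operation invoked in $H_S$ is invoked in $H$; every operation completed in $H$ is completed in $H_S$; if the response of $o_1$ precedes the invocation of $o_2$, both events are in $H_t$, and $o_2$ is in $H_S$,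 then $o_1$ precedes $o_2$ in $H_S$; and an operation whose response is in $H_t$ has the same response in $H_S$. $H$ is eventually linearizable if it is weakly consistent and has a $t$-linearization for some $t$; it is linearizable if it has a $0$-linearization. An implementation for $n$ processes of an object of type $O$ from shared objects consists of a program for each process, with a local state and Turing computable local computations, which performs the operations of $O$ by invoking the shared objects and finally returns a value. It is wait-free if each invoked operation terminates after finitely many steps of its process, regardless of the behaviour of the other processes. It is eventually linearizable if every history of the implemented object that it produces, finite or infinite, under any scheduling and for any invoked operations, is eventually linearizable. The eventual consensus number $e_m^r(T)$ of a data type $T$ is the largest $n$ such that eventually linearizable objects of type $T$ together with linearizable read/write registers have a wait-free eventually linearizable implementation of an $n$-process FAC object ($\infty$ if there is no largest $n$). **Corollary.** The eventual consensus number of read/write registers is $1$. That is, for every nonempty (coded) set $V$ of values of the FAC objects and every (coded) set $X$ of register values, the read/write register over $X$ has eventual consensus number $1$. -/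

import Mathlib

/-- A deterministic abstract data type: a transition system with a set of possible initial states
and a transition map. Invocations and return values are finite data (they are handled by Turing
machines), hence coded. -/
structure DataType where
  State : Type
  Inv : Type
  Res : Type
  [invCode : Primcodable Inv]
  [resCode : Primcodable Res]
  init : Set State
  step : State → Inv → Res × State

attribute [instance] DataType.invCode DataType.resCode

/-- The type `T` with its initial state fixed to `s`. -/
abbrev DataType.startingAt (T : DataType) (s : T.State) : DataType :=
  { T with init := {s} }

/-- The read/write register with values in `X`. Invocations: `none` is "read", `some x` is
"write `x`". Return values: `some x` is the value read, `none` acknowledges a write. -/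
abbrev registerType (X : Type) [Primcodable X] : DataType where
  State := X
  Inv := Option X
  Res := Option X
  init := Set.univ
  step s i := match i with
    | none => (some s, s)
    | some x => (none, x)

/-- The fetch-and-cons object with values in `V`: `fac v` adds `v` to the head of the list and
returns the whole list stored before. The list is initially empty. -/
abbrev facType (V : Type) [Primcodable V] : DataType where
  State := List V
  Inv := V
  Res := List V
  init := {[]}
  step l v := (l, v :: l)

/-! ### Histories -/

/-- A finite or infinite history on one object, with process names in `P`: at each instant at most
one event takes place, which is an invocation `(p, Sum.inl i)` or a response `(p, Sum.inr v)`.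
Instants without an event are insignificant. -/
abbrev History (P I V : Type) : Type := ℕ → Option (P × (I ⊕ V))

namespace History

variable {P I V : Type}

/-- No event of process `p` takes place strictly between the instants `j` and `k`. -/
def Quiet (H : History P I V) (p : P) (j k : ℕ) : Prop :=
  ∀ m, j < m → m < k → ∀ x, H m ≠ some (p, x)

/-- For each process, the subsequence of its events starts with an invocation, each invocation is
immediately followed by a response (unless it is the last event), and each response is immediately
preceded by an invocation. -/
def WellFormed (H : History P I V) : Prop :=
  (∀ p v k, H k = some (p, Sum.inr v) → ∃ j i, j < k ∧ H j = some (p, Sum.inl i) ∧ H.Quiet p j k) ∧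
  (∀ p i x j k, H j = some (p, Sum.inl i) → j < k → H k = some (p, x) → H.Quiet p j k →
    ∃ v, x = Sum.inr v)

/-- Operations are named by the instant of their invocation: the operation invoked at the
instant `o` is performed by `p` and has invocation `i`. -/
def Invoked (H : History P I V) (o : ℕ) (p : P) (i : I) : Prop :=
  H o = some (p, Sum.inl i)

/-- The operation invoked at the instant `o` returns `v` at the instant `m`. -/
def Returns (H : History P I V) (o m : ℕ) (v : V) : Prop :=
  ∃ p i, H.Invoked o p i ∧ o < m ∧ H m = some (p, Sum.inr v) ∧ H.Quiet p o m

/-- The event at the instant `k` is not among the first `t` events, so it belongs to the suffix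
that is left when the first `t` events are removed. -/
def InSuffix (H : History P I V) (t k : ℕ) : Prop :=
  t ≤ Nat.count (fun j => (H j).isSome = true) k

end History

/-- A finite or infinite sequence of completed operations, each of them given by its name and its
return value. This represents a sequential history in which every invocation is answered. -/
structure SeqHistory (V : Type) where
  at' : ℕ → Option (ℕ × V)
  initial_segment : ∀ k, at' k = none → at' (k + 1) = none

/-- `S` consists of operations of `H`, each of them at most once, and it satisfies the sequential
specification of `T`. -/
def SeqHistory.LegalFor {P : Type} {T : DataType} (S : SeqHistory T.Res)
    (H : History P T.Inv T.Res) : Prop :=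
  (∀ k l o v w, S.at' k = some (o, v) → S.at' l = some (o, w) → k = l) ∧
  ∃ s : ℕ → T.State, s 0 ∈ T.init ∧
    ∀ k o v, S.at' k = some (o, v) →
      ∃ p i, H.Invoked o p i ∧ T.step (s k) i = (v, s (k + 1))

/-- Weak consistency: each operation that returns has an explanation history `S`. -/
def WeaklyConsistent {P : Type} (T : DataType) (H : History P T.Inv T.Res) : Prop :=
  ∀ o₁ p₁ i₁ m v, H.Invoked o₁ p₁ i₁ → H.Returns o₁ m v →
    ∃ S : SeqHistory T.Res, S.LegalFor H ∧
      (∀ k o w, S.at' k = some (o, w) → o < m) ∧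
      (∀ o i, H.Invoked o p₁ i → o < o₁ → ∃ k w, S.at' k = some (o, w)) ∧
      (∃ k, S.at' k = some (o₁, v) ∧ S.at' (k + 1) = none)

/-- `S` is a `t`-linearization of `H`. (An unanswered invocation at the end of a linearization
would belong to an operation that is pending in `H` as well, and can be left out. So only sequential
histories of completed operations need to be considered.) -/
def IsLinearizationFrom {P : Type} (T : DataType) (H : History P T.Inv T.Res) (t : ℕ)
    (S : SeqHistory T.Res) : Prop :=
  S.LegalFor H ∧
  (∀ o m v, H.Returns o m v → ∃ k w, S.at' k = some (o, w)) ∧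
  (∀ o₁ m₁ v₁ o₂ p₂ i₂ k₂ w₂, H.Returns o₁ m₁ v₁ → H.Invoked o₂ p₂ i₂ → m₁ < o₂ →
    H.InSuffix t m₁ → H.InSuffix t o₂ → S.at' k₂ = some (o₂, w₂) →
      ∃ k₁ w₁, k₁ < k₂ ∧ S.at' k₁ = some (o₁, w₁)) ∧
  (∀ o m v, H.Returns o m v → H.InSuffix t m → ∃ k, S.at' k = some (o, v))

/-- `t`-linearizability of a well-formed history. -/
def LinearizableFrom {P : Type} (T : DataType) (H : History P T.Inv T.Res) (t : ℕ) : Prop :=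
  H.WellFormed ∧ ∃ S, IsLinearizationFrom T H t S

/-- Linearizability is `0`-linearizability. -/
def Linearizable {P : Type} (T : DataType) (H : History P T.Inv T.Res) : Prop :=
  LinearizableFrom T H 0

/-- Eventual linearizability: weak consistency, and `t`-linearizability for some `t`. -/
def EventuallyLinearizable {P : Type} (T : DataType) (H : History P T.Inv T.Res) : Prop :=
  H.WellFormed ∧ WeaklyConsistent T H ∧ ∃ t, LinearizableFrom T H t

/-! ### Implementations -/

/-- A program for `n` processes that implements an object of type `O` from shared objects of
type `T` (named by `Obj`) and shared registers with values in `Val` (named by `Reg`).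
Each process has a local state in `Loc`, which it keeps between its operations.
`onCall` updates it when an operation of `O` is invoked; then `next` tells, as long as the operation
is running, which shared object has to be invoked next, or which value has to be returned, and
`onReply` updates the local state when the invoked shared object responds.
All local computations are Turing computable. -/
structure Implementation (T O : DataType) (n : ℕ) where
  Obj : Type
  Reg : Type
  Val : Type
  Loc : Type
  [objCode : Primcodable Obj]
  [regCode : Primcodable Reg]
  [valCode : Primcodable Val]
  [locCode : Primcodable Loc]
  objInit : Obj → T.State
  objInit_mem : ∀ a, objInit a ∈ T.init
  regInit : Reg → Val
  start : Fin n → Loc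
  onCall : Fin n → Loc → O.Inv → Loc
  next : Fin n → Loc → ((Obj × T.Inv) ⊕ (Reg × (registerType Val).Inv)) ⊕ O.Res
  onReply : Fin n → Loc → T.Res ⊕ (registerType Val).Res → Loc
  computable_onCall : ∀ p, Computable₂ (onCall p)
  computable_next : ∀ p, Computable (next p)
  computable_onReply : ∀ p, Computable₂ (onReply p)

attribute [instance] Implementation.objCode Implementation.regCode Implementation.valCode
  Implementation.locCode

namespace Implementation

variable {T O : DataType} {n : ℕ}

/-- What a process is doing: it performs no operation, it runs its program, or it waits for
the response of a shared object of type `T` or of a register. -/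
inductive Phase (A : Implementation T O n) : Type
  | idle : A.Phase
  | running : A.Phase
  | waitObj (a : A.Obj) : A.Phase
  | waitReg (b : A.Reg) : A.Phase

/-- The events in an execution: invocations and responses of the implemented object, of the shared
objects of type `T`, and of the registers. -/
inductive Action (A : Implementation T O n) : Type
  | call (i : O.Inv) : A.Action
  | ret (v : O.Res) : A.Action
  | objInv (a : A.Obj) (i : T.Inv) : A.Action
  | objRes (a : A.Obj) (v : T.Res) : A.Action
  | regInv (b : A.Reg) (i : (registerType A.Val).Inv) : A.Action
  | regRes (b : A.Reg) (v : (registerType A.Val).Res) : A.Action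

/-- The local state and the phase of each process. -/
abbrev Config (A : Implementation T O n) : Type := Fin n → A.Loc × A.Phase

/-- The possible steps; the step `none` is a pause. Responses of shared objects are arbitrary here;
they are restricted by the consistency of the whole execution. -/
inductive Step (A : Implementation T O n) :
    A.Config → Option (Fin n × A.Action) → A.Config → Prop
  | pause (c : A.Config) : Step A c none c
  | call (c : A.Config) (p : Fin n) (l : A.Loc) (i : O.Inv) (hc : c p = (l, .idle)) :
      Step A c (some (p, .call i)) (Function.update c p (A.onCall p l i, .running))
  | ret (c : A.Config) (p : Fin n) (l : A.Loc) (v : O.Res) (hc : c p = (l, .running))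
      (hn : A.next p l = Sum.inr v) :
      Step A c (some (p, .ret v)) (Function.update c p (l, .idle))
  | objInv (c : A.Config) (p : Fin n) (l : A.Loc) (a : A.Obj) (i : T.Inv)
      (hc : c p = (l, .running)) (hn : A.next p l = Sum.inl (Sum.inl (a, i))) :
      Step A c (some (p, .objInv a i)) (Function.update c p (l, .waitObj a))
  | objRes (c : A.Config) (p : Fin n) (l : A.Loc) (a : A.Obj) (v : T.Res)
      (hc : c p = (l, .waitObj a)) :
      Step A c (some (p, .objRes a v))
        (Function.update c p (A.onReply p l (Sum.inl v), .running))
  | regInv (c : A.Config) (p : Fin n) (l : A.Loc) (b : A.Reg) (i : (registerType A.Val).Inv)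
      (hc : c p = (l, .running)) (hn : A.next p l = Sum.inl (Sum.inr (b, i))) :
      Step A c (some (p, .regInv b i)) (Function.update c p (l, .waitReg b))
  | regRes (c : A.Config) (p : Fin n) (l : A.Loc) (b : A.Reg) (v : (registerType A.Val).Res)
      (hc : c p = (l, .waitReg b)) :
      Step A c (some (p, .regRes b v))
        (Function.update c p (A.onReply p l (Sum.inr v), .running))

/-- A finite or infinite sequence of events; at some instants there may be no event. -/
abbrev Trace (A : Implementation T O n) : Type := ℕ → Option (Fin n × A.Action)

/-- The history of the implemented object. -/
def history (A : Implementation T O n) (e : A.Trace) : History (Fin n) O.Inv O.Res :=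
  fun k => match e k with
    | some (p, .call i) => some (p, Sum.inl i)
    | some (p, .ret v) => some (p, Sum.inr v)
    | _ => none

open Classical in
/-- The history of the shared object `a` of type `T`. -/
noncomputable def objHistory (A : Implementation T O n) (e : A.Trace) (a : A.Obj) :
    History (Fin n) T.Inv T.Res :=
  fun k => match e k with
    | some (p, .objInv a' i) => if a' = a then some (p, Sum.inl i) else none
    | some (p, .objRes a' v) => if a' = a then some (p, Sum.inr v) else none
    | _ => none

open Classical in
/-- The history of the register `b`. -/
noncomputable def regHistory (A : Implementation T O n) (e : A.Trace) (b : A.Reg) :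
    History (Fin n) (registerType A.Val).Inv (registerType A.Val).Res :=
  fun k => match e k with
    | some (p, .regInv b' i) => if b' = b then some (p, Sum.inl i) else none
    | some (p, .regRes b' v) => if b' = b then some (p, Sum.inr v) else none
    | _ => none

/-- The executions of the implementation in a system in which the objects of type `T` are
eventually linearizable and the registers are linearizable. The scheduling of the processes and the
invoked operations are arbitrary. -/
def IsExecution (A : Implementation T O n) (e : A.Trace) : Prop :=
  (∃ c : ℕ → A.Config, (∀ p, c 0 p = (A.start p, .idle)) ∧
    ∀ k, A.Step (c k) (e k) (c (k + 1))) ∧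
  (∀ a, EventuallyLinearizable (T.startingAt (A.objInit a)) (A.objHistory e a)) ∧
  (∀ b, Linearizable ((registerType A.Val).startingAt (A.regInit b)) (A.regHistory e b))

/-- Each operation terminates after finitely many steps of its process, regardless of the other
processes: if a process takes infinitely many steps, then each operation it invokes returns. -/
def WaitFree (A : Implementation T O n) : Prop :=
  ∀ e, A.IsExecution e → ∀ p, {k | ∃ x, e k = some (p, x)}.Infinite →
    ∀ o i, (A.history e).Invoked o p i → ∃ m v, (A.history e).Returns o m v

/-- All histories that the implementation produces are eventually linearizable. -/
def IsEventuallyLinearizable (A : Implementation T O n) : Prop :=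
  ∀ e, A.IsExecution e → EventuallyLinearizable O (A.history e)

end Implementation

/-- In a system of `n` processes, eventually linearizable objects of type `T` and linearizable
registers wait-free implement an eventually linearizable object of type `O`. -/
def WaitFreeEventuallyImplements (T O : DataType) (n : ℕ) : Prop :=
  ∃ A : Implementation T O n, A.WaitFree ∧ A.IsEventuallyLinearizable

/-- The eventual consensus number of `T`, with fetch-and-cons objects for values in `V`: the
largest `n` such that eventually linearizable objects of type `T` and linearizable registers
wait-free implement an `n`-process eventually linearizable fetch-and-cons object
(`⊤` if there is no largest such `n`). -/
noncomputable def eventualConsensusNumber (V : Type) [Primcodable V] (T : DataType) : ℕ∞ :=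
  sSup ((fun n : ℕ => (n : ℕ∞)) '' {n | WaitFreeEventuallyImplements T (facType V) n})

/-! A single process keeps the whole list in its local state, so `n = 1` is possible without any
shared object (`localFac`).

For `n ≥ 2` a valency argument applies, once the finite period in which the object may misbehave has
been passed. It is enough to consider schedules in which every access to a shared object is atomic:
then all shared objects are linearizable, hence eventually linearizable, so these schedules are
genuine executions (`isExecution_trace`).

Stabilization: suppose that every quiescent finite execution had a quiescent extension with a new
operation in which the lengths of the returned lists are wrong. Chaining such extensions gives one
infinite execution with infinitely many wrong blocks. But in a `t`-linearization an operation
returns a list whose length is its position, as long as its response is not among the first `t`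
events. The operations of the early period are finitely many and occupy bounded positions, and later
blocks are kept in real-time order, so some block is right (`exists_fitsBetween`). Hence after some
quiescent execution all lengths are right in every quiescent extension
(`exists_forall_fitsBetween`). Lengths carry enough information even if `V` has one element.

Valency: from that point `p` and `q` each invoke one operation. Say that a process wins if its list
has the length `c`, the number of earlier operations. In every completion exactly one process wins
(`Duel.length_eq_iff`), yet each wins if it runs alone from the start (`exists_soloReturns_length`).
Call a state balanced if the solo runs of `p` and `q` have the same outcome. The initial state is
balanced. In a balanced state neither process can be about to return, since the other could then
finish alone with the same outcome. For registers, a balanced state always leads to another one in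
one or two steps (`Balanced.step`). So there is an infinite schedule in which both operations stay
pending, contradicting wait-freedom. -/

namespace History

/-! ### Well-formed histories. -/

variable {P I V : Type}

theorem Returns.lt {H : History P I V} {o m : ℕ} {v : V} (h : H.Returns o m v) : o < m := by
  obtain ⟨p, i, -, h, -⟩ := h
  exact h

theorem Returns.congr {H H' : History P I V} {b o m : ℕ} {v : V} (hb : ∀ k < b, H k = H' k)
    (hm : m < b) (h : H.Returns o m v) : H'.Returns o m v := by
  obtain ⟨p, i, ho, hlt, hr, hq⟩ := h
  refine ⟨p, i, (hb o (hlt.trans hm)).symm.trans ho, hlt, (hb m hm).symm.trans hr, ?_⟩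
  intro k h1 h2 x hx
  exact hq k h1 h2 x ((hb k (h2.trans hm)).trans hx)

/-- The first event of `p` after an invocation by `p` is a response to it. -/
theorem WellFormed.returns_of_event {H : History P I V} (hH : H.WellFormed) {o k : ℕ} {p : P}
    {i : I} {x : I ⊕ V} (ho : H.Invoked o p i) (hk : o < k) (hx : H k = some (p, x)) :
    ∃ m v, m ≤ k ∧ H m = some (p, Sum.inr v) ∧ H.Returns o m v := by
  classical
  have hex : ∃ m, o < m ∧ ∃ x, H m = some (p, x) := ⟨k, hk, x, hx⟩
  obtain ⟨h1, y, h2⟩ := Nat.find_spec hex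
  have hq : H.Quiet p o (Nat.find hex) := fun m hm hm' x hx => Nat.find_min hex hm' ⟨hm, x, hx⟩
  obtain ⟨v, rfl⟩ := hH.2 p i y o _ ho h1 h2 hq
  exact ⟨_, v, Nat.find_min' hex ⟨hk, x, hx⟩, h2, p, i, ho, h1, h2, hq⟩

/-- A history is well-formed if it respects the flags `pend`, which tell when a process has a
pending operation. -/
theorem wellFormed_of_pending {H : History P I V} (pend : ℕ → P → Prop) (h0 : ∀ p, ¬ pend 0 p)
    (hinv : ∀ k p i, H k = some (p, Sum.inl i) → ¬ pend k p ∧ pend (k + 1) p)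
    (hres : ∀ k p v, H k = some (p, Sum.inr v) → pend k p ∧ ¬ pend (k + 1) p)
    (hnone : ∀ k p, (∀ x, H k ≠ some (p, x)) → (pend (k + 1) p ↔ pend k p)) : H.WellFormed := by
  have hpend : ∀ k p, pend k p → ∃ j i, j < k ∧ H j = some (p, Sum.inl i) ∧ H.Quiet p j k := by
    intro k p
    induction k with
    | zero => intro h; exact absurd h (h0 p)
    | succ k ih =>
      intro h
      by_cases hk : ∃ x, H k = some (p, x)
      · obtain ⟨x | x, hx⟩ := hk
        · exact ⟨k, x, k.lt_succ_self, hx, fun m h1 h2 => by omega⟩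
        · exact absurd h (hres k p x hx).2
      · push Not at hk
        obtain ⟨j, i, hj, hi, hq⟩ := ih ((hnone k p hk).1 h)
        refine ⟨j, i, hj.trans k.lt_succ_self, hi, fun m h1 h2 => ?_⟩
        rcases Nat.lt_succ_iff_lt_or_eq.1 h2 with h | rfl
        · exact hq m h1 h
        · exact hk
  refine ⟨fun p v k hk => hpend k p (hres k p v hk).1, ?_⟩
  intro p i x j k hj hjk hk hq
  have : ∀ m, j < m → m ≤ k → pend m p := by
    intro m hm
    induction m, hm using Nat.le_induction with
    | base => intro _; exact (hinv j p i hj).2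
    | succ m hm ih => intro h; exact (hnone m p (hq m hm h)).2 (ih (by omega))
  rcases x with i' | v
  · exact absurd (this k hjk le_rfl) (hinv k p i' hk).1
  · exact ⟨v, rfl⟩

end History

/-! ### Criteria for linearizability and eventual linearizability. -/

open Classical in
/-- An object is linearizable if each operation takes effect at the instant of its invocation. -/
theorem linearizable_of_invocation_points {P : Type} {T : DataType} {H : History P T.Inv T.Res}
    (hwf : H.WellFormed) (s : ℕ → T.State) (h0 : s 0 ∈ T.init)
    (hinv : ∀ k p i, H k = some (p, Sum.inl i) → s (k + 1) = (T.step (s k) i).2)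
    (hno : ∀ k, (∀ p i, H k ≠ some (p, Sum.inl i)) → s (k + 1) = s k)
    (hret : ∀ o m v p i, H.Invoked o p i → H.Returns o m v → v = (T.step (s o) i).1) :
    Linearizable T H := by
  let Q : ℕ → Prop := fun k => ∃ p i, H k = some (p, Sum.inl i)
  -- Pending operations get a response too: every invocation enters the linearization, at the
  -- position given by the number of earlier invocations.
  have hres : ∀ k, Q k → ∃ v, ∀ p i, H k = some (p, Sum.inl i) → v = (T.step (s k) i).1 := by
    rintro k ⟨p, i, hk⟩
    refine ⟨(T.step (s k) i).1, fun p' i' h => ?_⟩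
    rw [hk] at h
    simp only [Option.some.injEq, Prod.mk.injEq, Sum.inl.injEq] at h
    rw [h.2]
  choose r hr using hres
  have hcinj : ∀ k l, Q k → Q l → Nat.count Q k = Nat.count Q l → k = l :=
    fun k l hk hl h => Nat.count_injective hk hl h
  let at' : ℕ → Option (ℕ × T.Res) := fun j =>
    if h : ∃ k, Q k ∧ Nat.count Q k = j then some (h.choose, r h.choose h.choose_spec.1) else none
  have hat : ∀ j o v, at' j = some (o, v) ↔ ∃ ho : Q o, Nat.count Q o = j ∧ v = r o ho := by
    intro j o v
    by_cases h : ∃ k, Q k ∧ Nat.count Q k = j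
    · have hc := h.choose_spec
      simp only [at', dif_pos h, Option.some.injEq, Prod.mk.injEq]
      constructor
      · rintro ⟨rfl, rfl⟩; exact ⟨hc.1, hc.2, rfl⟩
      · rintro ⟨h1, h2, rfl⟩
        have h3 := hcinj _ _ hc.1 h1 (hc.2.trans h2.symm)
        generalize_proofs hQ
        subst h3
        exact ⟨rfl, rfl⟩
    · simp only [at', dif_neg h, reduceCtorEq, false_iff]
      rintro ⟨h1, h2, -⟩
      exact h ⟨o, h1, h2⟩
  have hsome : ∀ j, at' j ≠ none → ∃ o, Q o ∧ Nat.count Q o = j := by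
    intro j hj
    by_contra h
    exact hj (by simp only [at', dif_neg h])
  have hconst : ∀ a b, a ≤ b → Nat.count Q a = Nat.count Q b → s a = s b := by
    intro a b hab
    induction b, hab using Nat.le_induction with
    | base => intro _; rfl
    | succ b hb ih =>
      intro h
      have h1 : Nat.count Q a ≤ Nat.count Q b := Nat.count_monotone Q hb
      rw [Nat.count_succ] at h
      have h2 : ¬ Q b := by intro hQ; rw [if_pos hQ] at h; omega
      rw [if_neg h2] at h
      rw [ih h]
      refine (hno b fun p i hp => h2 ⟨p, i, hp⟩).symm
  refine ⟨hwf, ⟨at', ?_⟩, ?_⟩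
  · intro j hj
    by_contra h
    -- If position `j + 1` is occupied, there are more than `j` invocations, and the one with index
    -- `j` occupies position `j`.
    obtain ⟨o, ho, hc⟩ := hsome _ h
    have : j < Nat.count Q o := by omega
    have hj' : ∀ hf : (Set.ofPred Q).Finite, j < hf.toFinset.card := fun hf =>
      this.trans_le (Nat.count_le_card hf o)
    have h1 := Nat.nth_mem j hj'
    have h2 := Nat.count_nth hj'
    rw [(hat j _ _).2 ⟨h1, h2, rfl⟩] at hj
    simp at hj
  · have hS : ∀ o p i (h : H.Invoked o p i),
        at' (Nat.count Q o) = some (o, r o ⟨p, i, h⟩) := fun o p i h =>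
      (hat _ _ _).2 ⟨⟨p, i, h⟩, rfl, rfl⟩
    refine ⟨⟨?_, ?_⟩, ?_, ?_, ?_⟩
    · intro k l o v w hk hl
      obtain ⟨_, h1, -⟩ := (hat _ _ _).1 hk
      obtain ⟨_, h2, -⟩ := (hat _ _ _).1 hl
      exact h1.symm.trans h2
    -- The state before the operation at position `j` is read off at the first instant preceded by
    -- `j` invocations; by `hconst` any other such instant gives the same state. Beyond the last
    -- operation the value is irrelevant.
    · refine ⟨fun j => if h : ∃ k, Nat.count Q k = j then s (Nat.find h) else s 0, ?_, ?_⟩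
      · have : ∃ k, Nat.count Q k = 0 := ⟨0, Nat.count_zero Q⟩
        have h2 : Nat.find this = 0 := Nat.le_zero.1 (Nat.find_min' this (Nat.count_zero Q))
        simp only [dif_pos this, h2]
        exact h0
      · intro j o v hj
        obtain ⟨⟨p, i, hp⟩, hc, rfl⟩ := (hat _ _ _).1 hj
        refine ⟨p, i, hp, ?_⟩
        have e1 : ∃ k, Nat.count Q k = j := ⟨o, hc⟩
        have hc' : Nat.count Q (o + 1) = j + 1 := by
          rw [Nat.count_succ, if_pos ⟨p, i, hp⟩, hc]
        have e2 : ∃ k, Nat.count Q k = j + 1 := ⟨o + 1, hc'⟩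
        simp only [dif_pos e1, dif_pos e2]
        rw [hconst _ _ (Nat.find_min' e1 hc) ((Nat.find_spec e1).trans hc.symm),
          hconst _ _ (Nat.find_min' e2 hc') ((Nat.find_spec e2).trans hc'.symm),
          hinv o p i hp, hr o ⟨p, i, hp⟩ p i hp]
    · rintro o m v ⟨p, i, ho, -⟩
      exact ⟨_, _, hS o p i ho⟩
    · intro o₁ m₁ v₁ o₂ p₂ i₂ k₂ w₂ h1 h2 h3 _ _ h4
      have hlt := h1.lt
      obtain ⟨p, i, ho, -⟩ := h1
      refine ⟨_, _, ?_, hS o₁ p i ho⟩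
      obtain ⟨_, rfl, -⟩ := (hat _ _ _).1 h4
      exact Nat.count_strict_mono ⟨p, i, ho⟩ (hlt.trans h3)
    · intro o m v h _
      obtain ⟨p, i, ho, -⟩ := id h
      refine ⟨Nat.count Q o, ?_⟩
      rw [hret o m v p i ho h, ← hr o ⟨p, i, ho⟩ p i ho]
      exact hS o p i ho

/-- Weak consistency is witnessed by cutting the linearization off right after the operation in
question. Real-time order puts the earlier operations of the same process before the cut, and
everything invoked after the response behind it. -/
theorem Linearizable.eventuallyLinearizable {P : Type} {T : DataType}
    {H : History P T.Inv T.Res} (h : Linearizable T H) : EventuallyLinearizable T H := by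
  obtain ⟨hwf, S, hS⟩ := id h
  refine ⟨hwf, ?_, 0, h⟩
  obtain ⟨⟨huniq, s, hs0, hs⟩, hcompl, hreal, hresp⟩ := hS
  intro o₁ p₁ i₁ m v hinv hret
  obtain ⟨k, hk⟩ := hresp o₁ m v hret (Nat.zero_le _)
  have hcut : ∀ j x, (if j ≤ k then S.at' j else none) = some x ↔ j ≤ k ∧ S.at' j = some x := by
    intro j x
    by_cases hj : j ≤ k <;> simp [hj]
  refine ⟨⟨fun j => if j ≤ k then S.at' j else none, ?_⟩, ⟨?_, s, hs0, ?_⟩, ?_, ?_, k, ?_, ?_⟩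
  · intro j hj
    by_cases h : j + 1 ≤ k
    · rw [if_pos h]
      rw [if_pos (by omega)] at hj
      exact S.initial_segment j hj
    · rw [if_neg h]
  · intro j l o a b hj hl
    exact huniq j l o a b ((hcut _ _).1 hj).2 ((hcut _ _).1 hl).2
  · intro j o a hj
    exact hs j o a ((hcut _ _).1 hj).2
  · intro j o a hj
    obtain ⟨hjk, hj⟩ := (hcut _ _).1 hj
    obtain ⟨p, i, ho, -⟩ := hs j o a hj
    by_contra hlt
    have hne : m ≠ o := by
      rintro rfl
      obtain ⟨_, _, _, _, h, _⟩ := hret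
      rw [History.Invoked, h] at ho
      simp at ho
    obtain ⟨k₁, w₁, hlt', hk₁⟩ := hreal o₁ m v o p i j a hret ho (by omega) (Nat.zero_le _)
      (Nat.zero_le _) hj
    have := huniq _ _ _ _ _ hk hk₁
    omega
  · intro o i ho hlt
    obtain ⟨m', v', hm', hr', hret'⟩ := hwf.returns_of_event ho hlt hinv
    have hne : m' ≠ o₁ := by
      rintro rfl
      rw [History.Invoked, hr'] at hinv
      simp at hinv
    obtain ⟨k₁, w₁, hlt', hk₁⟩ := hreal o m' v' o₁ p₁ i₁ k v hret' hinv (by omega) (Nat.zero_le _)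
      (Nat.zero_le _) hk
    exact ⟨k₁, w₁, (hcut _ _).2 ⟨hlt'.le, hk₁⟩⟩
  · exact (hcut _ _).2 ⟨le_rfl, hk⟩
  · simp

/-! ### Lengths of the lists that a fetch-and-cons object returns. -/

namespace History

variable {P I V : Type}

open Classical in
/-- The number of operations invoked before the instant `k`. -/
noncomputable def invCount (H : History P I V) (k : ℕ) : ℕ :=
  Nat.count (fun j => ∃ p i, H.Invoked j p i) k

theorem invCount_congr {H H' : History P I V} {b : ℕ} (hb : ∀ k < b, H k = H' k) :
    H.invCount b = H'.invCount b := by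
  classical
  unfold invCount
  rw [Nat.count_eq_card_filter_range, Nat.count_eq_card_filter_range]
  congr 1
  refine Finset.filter_congr fun k hk => ?_
  simp only [Invoked, hb k (Finset.mem_range.1 hk)]

theorem invCount_le_add_card {H : History P I V} {a b : ℕ} (s : Finset ℕ)
    (hs : ∀ k p i, a ≤ k → k < b → H.Invoked k p i → k ∈ s) :
    H.invCount b ≤ H.invCount a + s.card := by
  classical
  unfold invCount
  rw [Nat.count_eq_card_filter_range, Nat.count_eq_card_filter_range]
  refine (Finset.card_le_card ?_).trans (Finset.card_union_le _ _)
  intro k hk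
  rw [Finset.mem_filter, Finset.mem_range] at hk
  rw [Finset.mem_union, Finset.mem_filter, Finset.mem_range]
  obtain ⟨hk, p, i, h⟩ := hk
  rcases lt_or_ge k a with h' | h'
  · exact Or.inl ⟨h', p, i, h⟩
  · exact Or.inr (hs k p i h' hk h)

/-- The operations on a fetch-and-cons object that are performed between the instants `a` and `b`
return lists of the lengths that are possible if all operations invoked before `a`, and no others
invoked outside this interval, take effect before them. -/
def FitsBetween (H : History P V (List V)) (a b : ℕ) : Prop :=
  (∀ o m v, a ≤ o → m < b → H.Returns o m v → H.invCount a ≤ v.length ∧ v.length < H.invCount b) ∧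
  ∀ o m v o' m' v', a ≤ o → m < b → a ≤ o' → m' < b → o ≠ o' →
    H.Returns o m v → H.Returns o' m' v' → v.length ≠ v'.length

theorem FitsBetween.congr {H H' : History P V (List V)} {a b : ℕ} (hab : a ≤ b)
    (hb : ∀ k < b, H k = H' k) (h : H.FitsBetween a b) : H'.FitsBetween a b := by
  have hb' : ∀ k < b, H' k = H k := fun k hk => (hb k hk).symm
  refine ⟨fun o m v h1 h2 h3 => ?_, fun o m v o' m' v' h1 h2 h3 h4 h5 h6 h7 => ?_⟩
  · rw [← invCount_congr hb, ← invCount_congr fun k hk => hb k (hk.trans_le hab)]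
    exact h.1 o m v h1 h2 (h3.congr hb' h2)
  · exact h.2 o m v o' m' v' h1 h2 h3 h4 h5 (h6.congr hb' h2) (h7.congr hb' h4)

end History

/-- If a history of a fetch-and-cons object has infinitely many quiescent instants, and operations
are invoked between any two of them, then eventual linearizability makes the operations between
some two of them return lists of the right lengths. -/
theorem exists_fitsBetween {P V : Type} [Primcodable V] {H : History P V (List V)} {t : ℕ}
    (hH : LinearizableFrom (facType V) H t) {b : ℕ → ℕ} (hb : StrictMono b)
    (hquiet : ∀ j o p i, H.Invoked o p i → o < b j → ∃ m v, m < b j ∧ H.Returns o m v)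
    (hcall : ∀ j, ∃ o p i, b j ≤ o ∧ o < b (j + 1) ∧ H.Invoked o p i) :
    ∃ j, H.FitsBetween (b j) (b (j + 1)) := by
  classical
  obtain ⟨-, S, ⟨huniq, s, hs0, hs⟩, hcompl, hreal, hresp⟩ := hH
  have hlt : ∀ o, ∃ j, o < b j := fun o => ⟨o + 1, hb.le_apply⟩
  have hpos : ∀ o, (∃ p i, H.Invoked o p i) → ∃ k w, S.at' k = some (o, w) := by
    rintro o ⟨p, i, ho⟩
    obtain ⟨j, hj⟩ := hlt o
    obtain ⟨m, v, -, h⟩ := hquiet j o p i ho hj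
    exact hcompl o m v h
  choose! pos res hpr using hpos
  have hinj : ∀ o o', (∃ p i, H.Invoked o p i) → (∃ p i, H.Invoked o' p i) → pos o = pos o' →
      o = o' := by
    intro o o' h h' heq
    have h1 := hpr o h
    have h2 := hpr o' h'
    rw [heq, h2] at h1
    simp only [Option.some.injEq, Prod.mk.injEq] at h1
    exact h1.1.symm
  -- Each block between consecutive `b j` contains an invocation, so at least `t` events precede `b
  -- t`.
  have hsuf : ∀ k, b t ≤ k → H.InSuffix t k := by
    intro k hk
    refine le_trans ?_ (Nat.count_monotone _ hk)
    clear hk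
    have : ∀ j, j ≤ Nat.count (fun j => (H j).isSome = true) (b j) := by
      intro j
      induction j with
      | zero => exact Nat.zero_le _
      | succ j ih =>
        obtain ⟨o, p, i, h1, h2, h3⟩ := hcall j
        have h4 : Nat.count (fun j => (H j).isSome = true) o <
            Nat.count (fun j => (H j).isSome = true) (b (j + 1)) :=
          Nat.count_strict_mono (by rw [show H o = _ from h3]; rfl) h2
        have := Nat.count_monotone (fun j => (H j).isSome = true) h1
        omega
    exact this t
  have hreal' : ∀ j o o', (∃ p i, H.Invoked o p i) → (∃ p i, H.Invoked o' p i) → b t ≤ o →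
      o < b j → b j ≤ o' → pos o < pos o' := by
    rintro j o o' ⟨p, i, ho⟩ ⟨p', i', ho'⟩ h1 h2 h3
    obtain ⟨m, v, hm, hret⟩ := hquiet j o p i ho h2
    have := hret.lt
    obtain ⟨k, w, hk, hkw⟩ := hreal o m v o' p' i' (pos o') (res o') hret ho' (hm.trans_le h3)
      (hsuf m (by omega)) (hsuf o' (by omega)) (hpr o' ⟨p', i', ho'⟩)
    rwa [huniq _ _ _ _ _ (hpr o ⟨p, i, ho⟩) hkw]
  -- Operations invoked before `b t` may be placed out of order, but there are finitely many of
  -- them, so their positions are bounded.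
  obtain ⟨K, hK⟩ : ∃ K, ∀ o < b t, pos o ≤ K :=
    ⟨(Finset.range (b t)).sup pos, fun o ho => Finset.le_sup (f := pos) (Finset.mem_range.2 ho)⟩
  -- Each of the blocks from `t` to `t + j - 1` contributes an operation that precedes `o` in `S`.
  have hgrow : ∀ j o, b (t + j) ≤ o → (∃ p i, H.Invoked o p i) → j ≤ pos o := by
    intro j
    induction j with
    | zero => intro _ _ _; exact Nat.zero_le _
    | succ j ih =>
      intro o ho hi
      obtain ⟨o', p, i, h1, h2, h3⟩ := hcall (t + j)
      have := hreal' (t + j + 1) o' o ⟨p, i, h3⟩ hi ((hb.monotone (by omega)).trans h1) h2 ho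
      have := ih o' h1 ⟨p, i, h3⟩
      omega
  -- From block `t + K + 1` on, positions exceed `K`, so the misplaced early operations come first
  -- as well, and the boundary `b j` separates `S`.
  have hord : ∀ j o o', t + K + 1 ≤ j → (∃ p i, H.Invoked o p i) → (∃ p i, H.Invoked o' p i) →
      o < b j → b j ≤ o' → pos o < pos o' := by
    intro j o o' hj ho ho' h1 h2
    rcases lt_or_ge o (b t) with h | h
    · have h3 := hK o h
      have h4 := hgrow (K + 1) o' ((hb.monotone (by omega : t + (K + 1) ≤ j)).trans h2) ho'
      omega
    · exact hreal' j o o' ho ho' h h1 h2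
  have hfill : ∀ k l, k ≤ l → S.at' l ≠ none → S.at' k ≠ none := by
    intro k l hkl
    induction l, hkl using Nat.le_induction with
    | base => exact id
    | succ l _ ih => exact fun h => ih fun h' => h (S.initial_segment l h')
  -- Every `fac` lengthens the list by one, so the state at position `k` has length `k`: a response
  -- reveals its position.
  have hlen : ∀ k, (∀ l < k, S.at' l ≠ none) → (s k).length = k := by
    intro k
    induction k with
    | zero => intro _; rw [show s 0 = [] from hs0]; rfl
    | succ k ih =>
      intro h
      obtain ⟨⟨o, v⟩, hov⟩ := Option.ne_none_iff_exists'.1 (h k k.lt_succ_self)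
      obtain ⟨p, i, -, h2⟩ := hs k o v hov
      have e : s (k + 1) = i :: s k := (Prod.ext_iff.1 h2).2.symm
      rw [e, List.length_cons, ih fun l hl => h l (hl.trans k.lt_succ_self)]
  have hval : ∀ o m v, b t ≤ m → H.Returns o m v → v.length = pos o := by
    intro o m v hm hret
    obtain ⟨k, hk⟩ := hresp o m v hret (hsuf m hm)
    obtain ⟨p, i, ho, -⟩ := hret
    have hkp := huniq _ _ _ _ _ (hpr o ⟨p, i, ho⟩) hk
    rw [hkp]
    obtain ⟨_, _, -, h2⟩ := hs k o v hk
    have e : v = s k := (Prod.ext_iff.1 h2).1.symm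
    rw [e]
    exact hlen k fun l hl => hfill l k hl.le (by rw [hk]; simp)
  have hinv : ∀ {o m v}, H.Returns o m v → ∃ p i, H.Invoked o p i := by
    rintro o m v ⟨p, i, h, -⟩
    exact ⟨p, i, h⟩
  have hbt : b t ≤ b (t + K + 1) := hb.monotone (by omega)
  refine ⟨t + K + 1, fun o m v h1 h2 h3 => ?_, fun o m v o' m' v' h1 h2 h3 h4 h5 h6 h7 => ?_⟩
  · have hm := h3.lt
    rw [hval o m v (by omega) h3]
    unfold History.invCount
    rw [Nat.count_eq_card_filter_range, Nat.count_eq_card_filter_range]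
    constructor
    · calc _ ≤ (Finset.range (pos o)).card := by
            refine Finset.card_le_card_of_injOn pos (fun o' ho' => ?_) (fun o₁ h₁ o₂ h₂ => ?_)
            · rw [Finset.mem_coe, Finset.mem_filter, Finset.mem_range] at ho'
              rw [Finset.mem_coe, Finset.mem_range]
              exact hord _ o' o le_rfl ho'.2 (hinv h3) ho'.1 h1
            · rw [Finset.mem_coe, Finset.mem_filter] at h₁ h₂
              exact hinj _ _ h₁.2 h₂.2
        _ = pos o := Finset.card_range _
    -- The positions up to `pos o` are all occupied, and by operations invoked before the end of the
    -- block; counting them gives the upper bound.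
    · have hop : ∀ l, l ≤ pos o → ∃ o', ∃ p i, H.Invoked o' p i ∧ pos o' = l ∧
          o' < b (t + K + 1 + 1) := by
        intro l hl
        obtain ⟨⟨o', w⟩, how⟩ := Option.ne_none_iff_exists'.1
          (hfill l (pos o) hl (by rw [hpr o (hinv h3)]; simp))
        obtain ⟨p, i, h, -⟩ := hs l o' w how
        have hl' := huniq _ _ _ _ _ (hpr o' ⟨p, i, h⟩) how
        refine ⟨o', p, i, h, hl', ?_⟩
        by_contra hge
        have := hord (t + K + 1 + 1) o o' (by omega) (hinv h3) ⟨p, i, h⟩ (by omega) (by omega)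
        omega
      choose! f hf using hop
      calc pos o < (Finset.range (pos o + 1)).card := by rw [Finset.card_range]; omega
        _ ≤ _ := by
          refine Finset.card_le_card_of_injOn f (fun l hl => ?_) (fun l hl l' hl' h => ?_)
          · rw [Finset.mem_coe, Finset.mem_range] at hl
            obtain ⟨p, i, h, -, h'⟩ := hf l (by omega)
            rw [Finset.mem_coe, Finset.mem_filter, Finset.mem_range]
            exact ⟨h', p, i, h⟩
          · rw [Finset.mem_coe, Finset.mem_range] at hl hl'
            obtain ⟨_, _, -, e, -⟩ := hf l (by omega)
            obtain ⟨_, _, -, e', -⟩ := hf l' (by omega)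
            rw [← e, ← e', h]
  · have hm := h6.lt
    have hm' := h7.lt
    rw [hval o m v (by omega) h6, hval o' m' v' (by omega) h7]
    exact fun h => h5 (hinj _ _ (hinv h6) (hinv h7) h)

/-! ### One process -/

/-- One process implements a fetch-and-cons object in its local state, which consists of the list
and of the value that the last operation returns. -/
def localFac (T : DataType) (V : Type) [Primcodable V] : Implementation T (facType V) 1 where
  Obj := Empty
  Reg := Empty
  Val := Unit
  Loc := List V × List V
  objInit := Empty.elim
  objInit_mem a := a.elim
  regInit := Empty.elim
  start _ := ([], [])
  onCall _ l v := (v :: l.1, l.1)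
  next _ l := Sum.inr l.2
  onReply _ l _ := l
  computable_onCall _ := (Primrec.pair
    (Primrec.list_cons.comp Primrec.snd (Primrec.fst.comp Primrec.fst))
    (Primrec.fst.comp Primrec.fst)).to_comp
  computable_next _ := (Primrec.sumInr.comp Primrec.snd).to_comp
  computable_onReply _ := Primrec.fst.to_comp

namespace localFac

open Implementation

variable {T : DataType} {V : Type} [Primcodable V]

/-- At each instant there is a pause, or an operation is invoked or returns. -/
theorem step_cases {c c' : (localFac T V).Config} {x : Option (Fin 1 × (localFac T V).Action)}
    (h : (localFac T V).Step c x c') :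
    (x = none ∧ c' 0 = c 0) ∨
    (∃ i, x = some (0, .call i) ∧ (c 0).2 = .idle ∧
      c' 0 = ((i :: (c 0).1.1, (c 0).1.1), .running)) ∨
    (x = some (0, .ret (c 0).1.2) ∧ (c 0).2 = .running ∧ c' 0 = ((c 0).1, .idle)) := by
  cases h with
  | pause => exact Or.inl ⟨rfl, rfl⟩
  | call p l i hc =>
    obtain rfl : p = 0 := Subsingleton.elim _ _
    refine Or.inr (Or.inl ⟨i, rfl, ?_, ?_⟩)
    · rw [hc]
    · rw [hc, Function.update_self]; rfl
  | ret p l v hc hn =>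
    obtain rfl : p = 0 := Subsingleton.elim _ _
    refine Or.inr (Or.inr ⟨?_, ?_, ?_⟩)
    · rw [hc]
      obtain rfl : l.2 = v := Sum.inr_injective hn
      rfl
    · rw [hc]
    · rw [hc, Function.update_self]
  | objInv p l a => exact a.elim
  | objRes p l a => exact a.elim
  | regInv p l a => exact a.elim
  | regRes p l a => exact a.elim

section Execution

variable {e : (localFac T V).Trace} {c : ℕ → (localFac T V).Config}

/-- The events of the implemented object and the local states. -/
theorem history_cases (hc : ∀ k, (localFac T V).Step (c k) (e k) (c (k + 1))) (k : ℕ) :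
    ((localFac T V).history e k = none ∧ c (k + 1) 0 = c k 0 ∧ e k = none) ∨
    (∃ i, (localFac T V).history e k = some (0, Sum.inl i) ∧ (c k 0).2 = .idle ∧
      c (k + 1) 0 = ((i :: (c k 0).1.1, (c k 0).1.1), .running)) ∨
    ((localFac T V).history e k = some (0, Sum.inr (c k 0).1.2) ∧ (c k 0).2 = .running ∧
      c (k + 1) 0 = ((c k 0).1, .idle)) := by
  rcases step_cases (hc k) with ⟨h, h'⟩ | ⟨i, h, h'⟩ | ⟨h, h'⟩
  · exact Or.inl ⟨by simp only [history, h], h', h⟩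
  · exact Or.inr (Or.inl ⟨i, by simp only [history, h], h'⟩)
  · exact Or.inr (Or.inr ⟨by simp only [history, h], h'⟩)

theorem history_wellFormed (h0 : ∀ p, c 0 p = ((localFac T V).start p, .idle))
    (hc : ∀ k, (localFac T V).Step (c k) (e k) (c (k + 1))) :
    ((localFac T V).history e).WellFormed := by
  refine History.wellFormed_of_pending (fun k _ => (c k 0).2 = .running) ?_ ?_ ?_ ?_
  · intro p; rw [h0]; simp
  · intro k p i h
    rcases history_cases hc k with ⟨h1, h2, -⟩ | ⟨_, h1, h2, h3⟩ | ⟨h1, h2, h3⟩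
    · rw [h1] at h; simp at h
    · rw [h2, h3]; simp
    · rw [h1] at h; simp at h
  · intro k p i h
    rcases history_cases hc k with ⟨h1, h2, -⟩ | ⟨_, h1, h2, h3⟩ | ⟨h1, h2, h3⟩
    · rw [h1] at h; simp at h
    · rw [h1] at h; simp at h
    · rw [h2, h3]; simp
  · intro k p h
    obtain rfl : p = 0 := Subsingleton.elim _ _
    rcases history_cases hc k with ⟨h1, h2, -⟩ | ⟨_, h1, h2, h3⟩ | ⟨h1, h2, h3⟩
    · rw [h2]
    · exact absurd h1 (h _)
    · exact absurd h1 (h _)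

/-- An operation takes effect at its invocation: there the old list is copied to the second
component, which stays fixed until the return. -/
theorem history_linearizable (h0 : ∀ p, c 0 p = ((localFac T V).start p, .idle))
    (hc : ∀ k, (localFac T V).Step (c k) (e k) (c (k + 1))) :
    Linearizable (facType V) ((localFac T V).history e) := by
  refine linearizable_of_invocation_points (history_wellFormed h0 hc) (fun k => (c k 0).1.1)
    ?_ ?_ ?_ ?_
  · change (c 0 0).1.1 = []
    rw [h0]; rfl
  · intro k p i h
    rcases history_cases hc k with ⟨h1, h2, -⟩ | ⟨i', h1, h2, h3⟩ | ⟨h1, h2, h3⟩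
    · rw [h1] at h; simp at h
    · rw [h1] at h
      simp only [Option.some.injEq, Prod.mk.injEq, Sum.inl.injEq] at h
      rw [h3, ← h.2]
    · rw [h1] at h; simp at h
  · intro k h
    rcases history_cases hc k with ⟨h1, h2, -⟩ | ⟨_, h1, h2, h3⟩ | ⟨h1, h2, h3⟩
    · rw [h2]
    · exact absurd h1 (h _ _)
    · rw [h3]
  · rintro o m v p i ho ⟨p', i', -, hlt, hr, hq⟩
    obtain rfl : p' = 0 := Subsingleton.elim _ _
    have hconst : (c m 0).1.2 = (c (o + 1) 0).1.2 := by
      have : ∀ k, o + 1 ≤ k → k ≤ m → (c k 0).1.2 = (c (o + 1) 0).1.2 := by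
        intro k hk
        induction k, hk using Nat.le_induction with
        | base => exact fun _ => rfl
        | succ k hk ih =>
          intro h
          have hq' := hq k hk h
          rcases history_cases hc k with ⟨h1, h2, -⟩ | ⟨_, h1, h2, h3⟩ | ⟨h1, h2, h3⟩
          · rw [h2]; exact ih (by omega)
          · exact absurd h1 (hq' _)
          · exact absurd h1 (hq' _)
      exact this m hlt le_rfl
    have h1 : v = (c m 0).1.2 := by
      rcases history_cases hc m with ⟨h1, -⟩ | ⟨_, h1, -⟩ | ⟨h1, -⟩
      · rw [h1] at hr; simp at hr
      · rw [h1] at hr; simp at hr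
      · rw [h1] at hr
        simp only [Option.some.injEq, Prod.mk.injEq, Sum.inr.injEq, true_and] at hr
        exact hr.symm
    have h2 : (c (o + 1) 0).1.2 = (c o 0).1.1 := by
      rcases history_cases hc o with ⟨h1, -⟩ | ⟨_, h1, -, h3⟩ | ⟨h1, -⟩
      · rw [History.Invoked, h1] at ho; simp at ho
      · rw [h3]
      · rw [History.Invoked, h1] at ho; simp at ho
    exact h1.trans (hconst.trans h2)

end Execution

theorem isEventuallyLinearizable : (localFac T V).IsEventuallyLinearizable := by
  rintro e ⟨⟨c, h0, hc⟩, -⟩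
  exact (history_linearizable h0 hc).eventuallyLinearizable

theorem waitFree : (localFac T V).WaitFree := by
  rintro e ⟨⟨c, h0, hc⟩, -⟩ p hinf o i ho
  obtain ⟨k, ⟨x, hk⟩, hok⟩ := hinf.exists_gt o
  -- Without shared objects every step of the process is an event of the implemented object.
  have hev : ∃ y, (localFac T V).history e k = some (p, y) := by
    obtain rfl : p = 0 := Subsingleton.elim _ _
    rcases history_cases hc k with ⟨-, -, h1⟩ | ⟨_, h1, -⟩ | ⟨h1, -⟩
    · rw [h1] at hk; simp at hk
    · exact ⟨_, h1⟩
    · exact ⟨_, h1⟩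
  obtain ⟨y, hy⟩ := hev
  obtain ⟨m, v, -, -, h⟩ := (history_wellFormed h0 hc).returns_of_event ho hok hy
  exact ⟨m, v, h⟩

end localFac

/-! ### Executions in which each access to a shared object is atomic -/

namespace Implementation

variable {T O : DataType} {n : ℕ} (A : Implementation T O n)

/-- The states of the shared objects and of the registers. -/
abbrev Memory : Type := (A.Obj → T.State) × (A.Reg → A.Val)

/-- An invocation of a shared object or of a register. -/
abbrev Access : Type := (A.Obj × T.Inv) ⊕ (A.Reg × (registerType A.Val).Inv)

/-- The local states of the processes, whether they perform an operation, and the memory. -/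
abbrev Sys : Type := (Fin n → A.Loc × Bool) × A.Memory

/-- A process is scheduled, either to invoke an operation or to take a step of its program. -/
abbrev Decision (_ : Implementation T O n) : Type := Option (Fin n × Option O.Inv)

variable {A}

open Classical in
/-- The response to an access, and the new state of the memory. -/
noncomputable def access (m : A.Memory) : A.Access → (T.Res ⊕ (registerType A.Val).Res) × A.Memory
  | .inl (a, i) => (.inl (T.step (m.1 a) i).1,
      (Function.update m.1 a (T.step (m.1 a) i).2, m.2))
  | .inr (b, i) => (.inr ((registerType A.Val).step (m.2 b) i).1,
      (m.1, Function.update m.2 b ((registerType A.Val).step (m.2 b) i).2))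

/-- The invocation event of an access. -/
def invAction : A.Access → A.Action
  | .inl (a, i) => .objInv a i
  | .inr (b, i) => .regInv b i

/-- The response event of an access. -/
noncomputable def resAction (m : A.Memory) : A.Access → A.Action
  | .inl (a, i) => .objRes a (T.step (m.1 a) i).1
  | .inr (b, i) => .regRes b ((registerType A.Val).step (m.2 b) i).1

/-- The phase of a process that waits for the response to an access. -/
def waitPhase : A.Access → A.Phase
  | .inl (a, _) => .waitObj a
  | .inr (b, _) => .waitReg b

/-- The new state of the system and the at most two events that a decision leads to. A decision
that cannot be carried out has no effect. -/
noncomputable def exec (g : A.Sys) :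
    A.Decision → A.Sys × Option (Fin n × A.Action) × Option (Fin n × A.Action)
  | none => (g, none, none)
  | some (p, some i) =>
    if (g.1 p).2 = true then (g, none, none)
    else ((Function.update g.1 p (A.onCall p (g.1 p).1 i, true), g.2), some (p, .call i), none)
  | some (p, none) =>
    if (g.1 p).2 = true then
      match A.next p (g.1 p).1 with
      | .inr v => ((Function.update g.1 p ((g.1 p).1, false), g.2), some (p, .ret v), none)
      | .inl x => ((Function.update g.1 p (A.onReply p (g.1 p).1 (access g.2 x).1, true),
          (access g.2 x).2), some (p, invAction x), some (p, resAction g.2 x))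
    else (g, none, none)

/-- The configuration of the processes between two atomic steps. -/
def toConfig (g : A.Sys) : A.Config :=
  fun p => ((g.1 p).1, if (g.1 p).2 = true then .running else .idle)

variable (A)

/-- The system after the first `k` decisions of a schedule. -/
noncomputable def run (d : ℕ → A.Decision) : ℕ → A.Sys
  | 0 => (fun p => (A.start p, false), A.objInit, A.regInit)
  | k + 1 => (exec (run d k) (d k)).1

/-- The trace of a schedule: the decision at `k` leads to the events at `2 * k` and `2 * k + 1`. -/
noncomputable def trace (d : ℕ → A.Decision) : A.Trace := fun j =>
  if j % 2 = 0 then (exec (A.run d (j / 2)) (d (j / 2))).2.1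
  else (exec (A.run d (j / 2)) (d (j / 2))).2.2

variable {A}

theorem trace_even (d : ℕ → A.Decision) (k : ℕ) :
    A.trace d (2 * k) = (exec (A.run d k) (d k)).2.1 := by
  simp [trace]

theorem trace_odd (d : ℕ → A.Decision) (k : ℕ) :
    A.trace d (2 * k + 1) = (exec (A.run d k) (d k)).2.2 := by
  have h1 : (2 * k + 1) % 2 = 1 := by omega
  have h2 : (2 * k + 1) / 2 = k := by omega
  simp [trace, h1, h2]

theorem run_congr {d d' : ℕ → A.Decision} {N : ℕ} (h : ∀ k < N, d k = d' k) {k : ℕ} (hk : k ≤ N) :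
    A.run d k = A.run d' k := by
  induction k with
  | zero => rfl
  | succ k ih => rw [run, run, ih (by omega), h k (by omega)]

theorem trace_congr {d d' : ℕ → A.Decision} {N : ℕ} (h : ∀ k < N, d k = d' k) {j : ℕ}
    (hj : j < 2 * N) : A.trace d j = A.trace d' j := by
  have : j / 2 < N := by omega
  unfold trace
  rw [run_congr h this.le, h _ this]

/-- What a decision may lead to. -/
theorem exec_cases (g : A.Sys) (x : A.Decision) :
    exec g x = (g, none, none) ∨
    (∃ p i, x = some (p, some i) ∧ (g.1 p).2 = false ∧
      exec g x = ((Function.update g.1 p (A.onCall p (g.1 p).1 i, true), g.2),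
        some (p, .call i), none)) ∨
    (∃ p v, x = some (p, none) ∧ (g.1 p).2 = true ∧ A.next p (g.1 p).1 = .inr v ∧
      exec g x = ((Function.update g.1 p ((g.1 p).1, false), g.2), some (p, .ret v), none)) ∨
    (∃ p y, x = some (p, none) ∧ (g.1 p).2 = true ∧ A.next p (g.1 p).1 = .inl y ∧
      exec g x = ((Function.update g.1 p (A.onReply p (g.1 p).1 (access g.2 y).1, true),
          (access g.2 y).2), some (p, invAction y), some (p, resAction g.2 y))) := by
  rcases x with _ | ⟨p, _ | i⟩
  · exact Or.inl rfl
  · by_cases hp : (g.1 p).2 = true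
    · rcases hn : A.next p (g.1 p).1 with y | v
      · exact Or.inr (Or.inr (Or.inr ⟨p, y, rfl, hp, hn, by simp only [exec, if_pos hp, hn]⟩))
      · exact Or.inr (Or.inr (Or.inl ⟨p, v, rfl, hp, hn, by simp only [exec, if_pos hp, hn]⟩))
    · exact Or.inl (by simp only [exec, if_neg hp])
  · by_cases hp : (g.1 p).2 = true
    · exact Or.inl (by simp only [exec, if_pos hp])
    · exact Or.inr (Or.inl ⟨p, i, rfl, by simpa using hp, by simp only [exec, if_neg hp]⟩)

theorem toConfig_update (g : A.Sys) (p : Fin n) (l : A.Loc) (b : Bool) (m : A.Memory) :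
    toConfig (Function.update g.1 p (l, b), m) =
      Function.update (toConfig g) p (l, if b = true then .running else .idle) := by
  funext q
  rcases eq_or_ne q p with rfl | h
  · simp [toConfig]
  · simp [toConfig, h]

/-- The configurations of the trace of a schedule. -/
theorem exists_step (g : A.Sys) (x : A.Decision) :
    ∃ c, A.Step (toConfig g) (exec g x).2.1 c ∧ A.Step c (exec g x).2.2 (toConfig (exec g x).1) := by
  rcases exec_cases g x with h | ⟨p, i, -, hp, h⟩ | ⟨p, v, -, hp, hn, h⟩ | ⟨p, y, -, hp, hn, h⟩
  · rw [h]; exact ⟨_, .pause _, .pause _⟩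
  · rw [h]
    refine ⟨_, ?_, .pause _⟩
    rw [toConfig_update]
    exact Step.call _ p _ i (by simp [toConfig, hp])
  · rw [h]
    refine ⟨_, ?_, .pause _⟩
    rw [toConfig_update]
    exact Step.ret _ p _ v (by simp [toConfig, hp]) hn
  · rw [h]
    refine ⟨Function.update (toConfig g) p ((g.1 p).1, waitPhase y), ?_, ?_⟩
    · rcases y with ⟨a, i⟩ | ⟨b, i⟩
      · exact Step.objInv _ p _ a i (by simp [toConfig, hp]) hn
      · exact Step.regInv _ p _ b i (by simp [toConfig, hp]) hn
    · rw [toConfig_update, if_pos rfl]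
      rcases y with ⟨a, i⟩ | ⟨b, i⟩
      · have := Step.objRes (A := A) (Function.update (toConfig g) p ((g.1 p).1, .waitObj a)) p
          (g.1 p).1 a (T.step (g.2.1 a) i).1 (by simp)
        rwa [Function.update_idem] at this
      · have := Step.regRes (A := A) (Function.update (toConfig g) p ((g.1 p).1, .waitReg b)) p
          (g.1 p).1 b ((registerType A.Val).step (g.2.2 b) i).1 (by simp)
        rwa [Function.update_idem] at this

/-- A shared object whose operations are answered at once is linearizable. -/
theorem linearizable_of_immediate_responses {P : Type} {T : DataType}
    {H : History P T.Inv T.Res} (s : ℕ → T.State) (h0 : s 0 ∈ T.init)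
    (h : ∀ k, (H (2 * k) = none ∧ H (2 * k + 1) = none ∧ s (k + 1) = s k) ∨
      ∃ p i, H (2 * k) = some (p, Sum.inl i) ∧
        H (2 * k + 1) = some (p, Sum.inr (T.step (s k) i).1) ∧
        s (k + 1) = (T.step (s k) i).2) :
    Linearizable T H := by
  have hinv : ∀ j p i, H j = some (p, Sum.inl i) → ∃ k, j = 2 * k ∧
      H (2 * k + 1) = some (p, Sum.inr (T.step (s k) i).1) ∧ s (k + 1) = (T.step (s k) i).2 := by
    intro j p i hj
    obtain ⟨k, rfl | rfl⟩ := Nat.even_or_odd' j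
    · refine ⟨k, rfl, ?_⟩
      rcases h k with ⟨h1, -⟩ | ⟨p', i', h1, h2, h3⟩
      · rw [h1] at hj; simp at hj
      · rw [h1] at hj
        simp only [Option.some.injEq, Prod.mk.injEq, Sum.inl.injEq] at hj
        rw [← hj.1, ← hj.2]
        exact ⟨h2, h3⟩
    · rcases h k with ⟨-, h1, -⟩ | ⟨p', i', -, h2, -⟩
      · rw [h1] at hj; simp at hj
      · rw [h2] at hj; simp at hj
  have hres : ∀ j p v, H j = some (p, Sum.inr v) → ∃ k i, j = 2 * k + 1 ∧
      H (2 * k) = some (p, Sum.inl i) := by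
    intro j p v hj
    obtain ⟨k, rfl | rfl⟩ := Nat.even_or_odd' j
    · rcases h k with ⟨h1, -⟩ | ⟨p', i', h1, -⟩
      · rw [h1] at hj; simp at hj
      · rw [h1] at hj; simp at hj
    · rcases h k with ⟨-, h1, -⟩ | ⟨p', i', h1, h2, -⟩
      · rw [h1] at hj; simp at hj
      · rw [h2] at hj
        simp only [Option.some.injEq, Prod.mk.injEq] at hj
        exact ⟨k, i', rfl, by rw [h1, hj.1]⟩
  have hwf : H.WellFormed := by
    constructor
    · intro p v j hj
      obtain ⟨k, i, rfl, hk⟩ := hres j p v hj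
      exact ⟨2 * k, i, by omega, hk, fun m h1 h2 => by omega⟩
    · intro p i x j l hj hjl hl hq
      obtain ⟨k, rfl, hk, -⟩ := hinv j p i hj
      rcases Nat.lt_or_ge (2 * k + 1) l with h' | h'
      · exact absurd hk (hq _ (by omega) h' _)
      · obtain rfl : l = 2 * k + 1 := by omega
        rw [hk] at hl
        simp only [Option.some.injEq, Prod.mk.injEq, true_and] at hl
        exact ⟨_, hl.symm⟩
  -- The index `(j + 1) / 2` makes the state change between the instants `2 * k` and `2 * k + 1`,
  -- that is, at the invocation.
  refine linearizable_of_invocation_points hwf (fun j => s ((j + 1) / 2))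
    (by simpa using h0) ?_ ?_ ?_
  · intro j p i hj
    obtain ⟨k, rfl, -, hk⟩ := hinv j p i hj
    rw [show (2 * k + 1 + 1) / 2 = k + 1 by omega, show (2 * k + 1) / 2 = k by omega, hk]
  · intro j hj
    obtain ⟨k, rfl | rfl⟩ := Nat.even_or_odd' j
    · rw [show (2 * k + 1 + 1) / 2 = k + 1 by omega, show (2 * k + 1) / 2 = k by omega]
      rcases h k with ⟨-, -, h1⟩ | ⟨p, i, h1, -⟩
      · exact h1
      · exact absurd h1 (hj p i)
    · rw [show (2 * k + 1 + 1 + 1) / 2 = k + 1 by omega, show (2 * k + 1 + 1) / 2 = k + 1 by omega]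
  · rintro o m v p i ho ⟨p', i', ho', hlt, hr, hq⟩
    obtain ⟨k, rfl, hk, -⟩ := hinv o p i ho
    rw [History.Invoked, ho] at ho'
    simp only [Option.some.injEq, Prod.mk.injEq, Sum.inl.injEq] at ho'
    obtain ⟨rfl, rfl⟩ := ho'
    rcases Nat.lt_or_ge (2 * k + 1) m with h' | h'
    · exact absurd hk (hq _ (by omega) h' _)
    · obtain rfl : m = 2 * k + 1 := by omega
      rw [hk] at hr
      simp only [Option.some.injEq, Prod.mk.injEq, Sum.inr.injEq, true_and] at hr
      rw [show (2 * k + 1) / 2 = k by omega, hr]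

theorem objHistory_trace_linearizable (d : ℕ → A.Decision) (a : A.Obj) :
    Linearizable (T.startingAt (A.objInit a)) (A.objHistory (A.trace d) a) := by
  refine linearizable_of_immediate_responses (T := T.startingAt (A.objInit a))
    (fun k => (A.run d k).2.1 a) rfl fun k => ?_
  simp only [objHistory, trace_even, trace_odd, run]
  rcases exec_cases (A.run d k) (d k) with
    h | ⟨p, i, -, hp, h⟩ | ⟨p, v, -, hp, hn, h⟩ | ⟨p, y, -, hp, hn, h⟩
  · simp [h]
  · simp [h]
  · simp [h]
  · rcases y with ⟨a', i⟩ | ⟨b, i⟩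
    · by_cases ha : a' = a
      · subst ha
        exact Or.inr ⟨p, i, by simp [h, invAction], by simp [h, resAction], by simp [h, access]⟩
      · have ha' : a ≠ a' := fun h => ha h.symm
        exact Or.inl ⟨by simp [h, invAction, ha], by simp [h, resAction, ha],
          by simp [h, access, ha']⟩
    · exact Or.inl ⟨by simp [h, invAction], by simp [h, resAction], by simp [h, access]⟩

theorem regHistory_trace_linearizable (d : ℕ → A.Decision) (b : A.Reg) :
    Linearizable ((registerType A.Val).startingAt (A.regInit b))
      (A.regHistory (A.trace d) b) := by
  refine linearizable_of_immediate_responses (T := (registerType A.Val).startingAt (A.regInit b))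
    (fun k => (A.run d k).2.2 b) rfl fun k => ?_
  simp only [regHistory, trace_even, trace_odd, run]
  rcases exec_cases (A.run d k) (d k) with
    h | ⟨p, i, -, hp, h⟩ | ⟨p, v, -, hp, hn, h⟩ | ⟨p, y, -, hp, hn, h⟩
  · simp [h]
  · simp [h]
  · simp [h]
  · rcases y with ⟨a, i⟩ | ⟨b', i⟩
    · exact Or.inl ⟨by simp [h, invAction], by simp [h, resAction], by simp [h, access]⟩
    · by_cases ha : b' = b
      · subst ha
        exact Or.inr ⟨p, i, by simp [h, invAction], by simp [h, resAction], by simp [h, access]⟩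
      · have ha' : b ≠ b' := fun h => ha h.symm
        exact Or.inl ⟨by simp [h, invAction, ha], by simp [h, resAction, ha],
          by simp [h, access, ha']⟩

/-- This is what lets wait-freedom and eventual linearizability of the implementation be applied to
atomic schedules. At odd instants the process that accesses an object is in a waiting phase. -/
theorem isExecution_trace (d : ℕ → A.Decision) : A.IsExecution (A.trace d) := by
  refine ⟨?_, fun a => (objHistory_trace_linearizable d a).eventuallyLinearizable,
    regHistory_trace_linearizable d⟩
  choose c hc hc' using fun k => exists_step (A.run d k) (d k)
  refine ⟨fun j => if j % 2 = 0 then toConfig (A.run d (j / 2)) else c (j / 2), ?_, ?_⟩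
  · intro p; simp [toConfig, run]
  · intro j
    obtain ⟨k, rfl | rfl⟩ := Nat.even_or_odd' j
    · have h1 : (2 * k + 1) % 2 = 1 := by omega
      have h2 : (2 * k + 1) / 2 = k := by omega
      rw [trace_even]
      simpa [h1, h2] using hc k
    · have h1 : (2 * k + 1) % 2 = 1 := by omega
      have h2 : (2 * k + 1) / 2 = k := by omega
      have h3 : (2 * k + 1 + 1) % 2 = 0 := by omega
      have h4 : (2 * k + 1 + 1) / 2 = k + 1 := by omega
      rw [trace_odd]
      simpa [h1, h2, h3, h4, run] using hc' k

end Implementation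

/-! ### Limits of finite schedules. -/

/-- An infinite sequence is obtained by extending its finite prefixes step by step. -/
theorem exists_limit_of_extension {D : Type} {P : (ℕ → D) → ℕ → Prop}
    {R : (ℕ → D) → ℕ → ℕ → Prop}
    (hP : ∀ d d' N, (∀ k < N, d k = d' k) → P d N → P d' N)
    (hR : ∀ d d' M N, (∀ k < N, d k = d' k) → M < N → R d M N → R d' M N)
    {d₀ : ℕ → D} {N₀ : ℕ} (h0 : P d₀ N₀)
    (hext : ∀ d N, P d N → ∃ d' N', N < N' ∧ (∀ k < N, d' k = d k) ∧ P d' N' ∧ R d' N N') :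
    ∃ (d : ℕ → D) (N : ℕ → ℕ), StrictMono N ∧ ∀ j, P d (N j) ∧ R d (N j) (N (j + 1)) := by
  let S := {x : (ℕ → D) × ℕ // P x.1 x.2}
  have hex : ∀ x : S, ∃ y : S, x.1.2 < y.1.2 ∧ (∀ k < x.1.2, y.1.1 k = x.1.1 k) ∧
      R y.1.1 x.1.2 y.1.2 := by
    rintro ⟨⟨d, N⟩, h⟩
    obtain ⟨d', N', h1, h2, h3, h4⟩ := hext d N h
    exact ⟨⟨(d', N'), h3⟩, h1, h2, h4⟩
  choose f hlt hagree hrel using hex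
  let x : ℕ → S := fun j => f^[j] ⟨(d₀, N₀), h0⟩
  have hx : ∀ j, x (j + 1) = f (x j) := fun j => Function.iterate_succ_apply' f j _
  have hmono : StrictMono fun j => (x j).1.2 := strictMono_nat_of_lt_succ fun j => by
    rw [hx]; exact hlt (x j)
  have hag : ∀ i j, i ≤ j → ∀ k < (x i).1.2, (x j).1.1 k = (x i).1.1 k := by
    intro i j hij k hk
    induction j, hij using Nat.le_induction with
    | base => rfl
    | succ j hij ih =>
      rw [hx, hagree (x j) k (hk.trans_le (hmono.monotone hij)), ih]
  have hd : ∀ j, ∀ k < (x j).1.2, (x j).1.1 k = (x (k + 1)).1.1 k := by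
    intro j k hk
    have hk' : k < (x (k + 1)).1.2 := hmono.le_apply
    rcases le_total j (k + 1) with h | h
    · exact (hag _ _ h k hk).symm
    · exact hag _ _ h k hk'
  -- The entry at `k` is final in `x (k + 1)`, whose prefix is longer than `k` because the lengths
  -- strictly increase.
  refine ⟨fun k => (x (k + 1)).1.1 k, fun j => (x j).1.2, hmono, fun j => ⟨?_, ?_⟩⟩
  · exact hP _ _ _ (hd j) (x j).2
  · refine hR _ _ _ _ (hd (j + 1)) (hmono j.lt_succ_self) ?_
    simp only [hx]
    exact hrel (x j)

/-! ### Calls, returns and wait-freedom in atomic schedules. -/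

namespace Implementation

section Schedules

variable {T O : DataType} {n : ℕ} {A : Implementation T O n}

theorem exec_call {g : A.Sys} {p : Fin n} (i : O.Inv) (hp : (g.1 p).2 = false) :
    (exec g (some (p, some i))).1 =
      (Function.update g.1 p (A.onCall p (g.1 p).1 i, true), g.2) := by
  simp [exec, hp]

theorem exec_ret {g : A.Sys} {p : Fin n} {v : O.Res} (hp : (g.1 p).2 = true)
    (hn : A.next p (g.1 p).1 = .inr v) :
    (exec g (some (p, none))).1 = (Function.update g.1 p ((g.1 p).1, false), g.2) := by
  simp [exec, hp, hn]

theorem exec_access {g : A.Sys} {p : Fin n} {y : A.Access} (hp : (g.1 p).2 = true)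
    (hn : A.next p (g.1 p).1 = .inl y) :
    (exec g (some (p, none))).1 =
      (Function.update g.1 p (A.onReply p (g.1 p).1 (access g.2 y).1, true),
        (access g.2 y).2) := by
  simp [exec, hp, hn]

theorem exec_of_ne {g : A.Sys} {p r : Fin n} (h : r ≠ p) (i : Option O.Inv) :
    (exec g (some (p, i))).1.1 r = g.1 r := by
  rcases exec_cases g (some (p, i)) with e | ⟨p', j, hx, -, e⟩ | ⟨p', v, hx, -, -, e⟩ |
    ⟨p', y, hx, -, -, e⟩ <;> rw [e]
  all_goals
    simp only [Option.some.injEq, Prod.mk.injEq] at hx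
    rw [← hx.1]
    simp [h]

/-- The history of the implemented object in the trace of a schedule. -/
theorem history_trace_cases (d : ℕ → A.Decision) (j : ℕ) :
    A.history (A.trace d) j = none ∨
    (∃ k p i, j = 2 * k ∧ d k = some (p, some i) ∧ ((A.run d k).1 p).2 = false ∧
      ((A.run d (k + 1)).1 p).2 = true ∧ A.history (A.trace d) j = some (p, Sum.inl i)) ∨
    (∃ k p v, j = 2 * k ∧ d k = some (p, none) ∧ ((A.run d k).1 p).2 = true ∧
      ((A.run d (k + 1)).1 p).2 = false ∧ A.next p ((A.run d k).1 p).1 = .inr v ∧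
      A.history (A.trace d) j = some (p, Sum.inr v)) := by
  obtain ⟨k, rfl | rfl⟩ := Nat.even_or_odd' j
  · rcases exec_cases (A.run d k) (d k) with
      h | ⟨p, i, hd, hp, h⟩ | ⟨p, v, hd, hp, hn, h⟩ | ⟨p, y, hd, hp, hn, h⟩
    · left; simp [history, trace_even, h]
    · right; left
      exact ⟨k, p, i, rfl, hd, hp, by simp [run, h], by simp [history, trace_even, h]⟩
    · right; right
      exact ⟨k, p, v, rfl, hd, hp, by simp [run, h], hn, by simp [history, trace_even, h]⟩
    · left
      rcases y with y | y <;> simp [history, trace_even, h, invAction]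
  · left
    rcases exec_cases (A.run d k) (d k) with
      h | ⟨p, i, hd, hp, h⟩ | ⟨p, v, hd, hp, hn, h⟩ | ⟨p, y, hd, hp, hn, h⟩
    · simp [history, trace_odd, h]
    · simp [history, trace_odd, h]
    · simp [history, trace_odd, h]
    · rcases y with y | y <;> simp [history, trace_odd, h, resAction]

theorem invoked_trace_iff {d : ℕ → A.Decision} {o : ℕ} {p : Fin n} {i : O.Inv} :
    (A.history (A.trace d)).Invoked o p i ↔
      ∃ k, o = 2 * k ∧ d k = some (p, some i) ∧ ((A.run d k).1 p).2 = false := by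
  constructor
  · intro h
    rw [History.Invoked] at h
    rcases history_trace_cases d o with h' | ⟨k, p', i', h1, h2, h3, -, h'⟩ |
      ⟨k, p', v, -, -, -, -, -, h'⟩
    · rw [h'] at h; simp at h
    · rw [h'] at h
      simp only [Option.some.injEq, Prod.mk.injEq, Sum.inl.injEq] at h
      obtain ⟨rfl, rfl⟩ := h
      exact ⟨k, h1, h2, h3⟩
    · rw [h'] at h; simp at h
  · rintro ⟨k, rfl, h1, h2⟩
    simp [History.Invoked, history, trace_even, exec, h1, h2]

theorem response_trace_iff {d : ℕ → A.Decision} {m : ℕ} {p : Fin n} {v : O.Res} :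
    A.history (A.trace d) m = some (p, Sum.inr v) ↔
      ∃ k, m = 2 * k ∧ d k = some (p, none) ∧ ((A.run d k).1 p).2 = true ∧
        A.next p ((A.run d k).1 p).1 = .inr v := by
  constructor
  · intro h
    rcases history_trace_cases d m with h' | ⟨k, p', i', -, -, -, -, h'⟩ |
      ⟨k, p', v', h1, h2, h3, -, h4, h'⟩
    · rw [h'] at h; simp at h
    · rw [h'] at h; simp at h
    · rw [h'] at h
      simp only [Option.some.injEq, Prod.mk.injEq, Sum.inr.injEq] at h
      obtain ⟨rfl, rfl⟩ := h
      exact ⟨k, h1, h2, h3, h4⟩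
  · rintro ⟨k, rfl, h1, h2, h3⟩
    simp [history, trace_even, exec, h1, h2, h3]

/-- A process that runs from its call until it returns. -/
theorem returns_trace {d : ℕ → A.Decision} {a b : ℕ} {p : Fin n} {i : O.Inv} {v : O.Res}
    (hab : a < b) (ha : d a = some (p, some i)) (ha' : ((A.run d a).1 p).2 = false)
    (hrun : ∀ k, a < k → k ≤ b → ((A.run d k).1 p).2 = true) (hb : d b = some (p, none))
    (hn : A.next p ((A.run d b).1 p).1 = .inr v) :
    (A.history (A.trace d)).Returns (2 * a) (2 * b) v := by
  refine ⟨p, i, invoked_trace_iff.2 ⟨a, rfl, ha, ha'⟩, by omega,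
    response_trace_iff.2 ⟨b, rfl, hb, hrun b hab le_rfl, hn⟩, ?_⟩
  rintro m h1 h2 (x | x) hx
  · obtain ⟨k, rfl, -, h⟩ := invoked_trace_iff.1 hx
    rw [hrun k (by omega) (by omega)] at h
    simp at h
  · obtain ⟨k, rfl, h3, h4, h5⟩ := response_trace_iff.1 hx
    have h6 := hrun (k + 1) (by omega) (by omega)
    rw [run, h3, exec_ret h4 h5] at h6
    simp at h6

/-- A process stops running only when it returns. -/
theorem exists_return {d : ℕ → A.Decision} {a b : ℕ} {p : Fin n} (hab : a < b)
    (ha : ((A.run d a).1 p).2 = true) (hb : ((A.run d b).1 p).2 = false) :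
    ∃ k v, a ≤ k ∧ k < b ∧ (∀ l, a ≤ l → l ≤ k → ((A.run d l).1 p).2 = true) ∧
      d k = some (p, none) ∧ A.next p ((A.run d k).1 p).1 = .inr v := by
  classical
  have hex : ∃ l, a < l ∧ ((A.run d l).1 p).2 = false := ⟨b, hab, hb⟩
  obtain ⟨h1, h2⟩ := Nat.find_spec hex
  have hmin : ∀ l, a ≤ l → l < Nat.find hex → ((A.run d l).1 p).2 = true := by
    intro l hl hlt
    rcases hl.eq_or_lt with rfl | hl
    · exact ha
    · by_contra h
      exact Nat.find_min hex hlt ⟨hl, by simpa using h⟩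
  have hle : Nat.find hex ≤ b := Nat.find_min' hex ⟨hab, hb⟩
  obtain ⟨k, hk⟩ : ∃ k, Nat.find hex = k + 1 := ⟨Nat.find hex - 1, by omega⟩
  rw [hk] at h1 h2 hmin hle
  have hrun := hmin k (by omega) (by omega)
  rw [run] at h2
  rcases exec_cases (A.run d k) (d k) with
    e | ⟨p', i, hd, hp, e⟩ | ⟨p', v, hd, hp, hn, e⟩ | ⟨p', y, hd, hp, hn, e⟩
  · rw [e, hrun] at h2; simp at h2
  · rw [e] at h2
    by_cases h' : p = p'
    · subst h'; simp at h2
    · simp [h', hrun] at h2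
  · by_cases h' : p = p'
    · subst h'
      exact ⟨k, v, by omega, by omega, fun l h h' => hmin l h (by omega), hd, hn⟩
    · rw [e] at h2; simp [h', hrun] at h2
  · rw [e] at h2
    by_cases h' : p = p'
    · subst h'; simp at h2
    · simp [h', hrun] at h2

/-- A running process has been called. -/
theorem exists_call {d : ℕ → A.Decision} {b : ℕ} {p : Fin n}
    (hb : ((A.run d b).1 p).2 = true) :
    ∃ a i, a < b ∧ d a = some (p, some i) ∧ ((A.run d a).1 p).2 = false ∧
      ∀ k, a < k → k ≤ b → ((A.run d k).1 p).2 = true := by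
  induction b with
  | zero => simp [run] at hb
  | succ b ih =>
    cases hb' : ((A.run d b).1 p).2 with
    | true =>
      obtain ⟨a, i, h1, h2, h3, h4⟩ := ih hb'
      refine ⟨a, i, by omega, h2, h3, fun k h5 h6 => ?_⟩
      rcases Nat.le_succ_iff.1 h6 with h | rfl
      · exact h4 k h5 h
      · exact hb
    | false =>
      rw [run] at hb
      have hcall : ∃ i, d b = some (p, some i) := by
        rcases exec_cases (A.run d b) (d b) with
          e | ⟨p', i, hd, hp, e⟩ | ⟨p', v, hd, hp, hn, e⟩ | ⟨p', y, hd, hp, hn, e⟩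
        · rw [e, hb'] at hb; simp at hb
        · by_cases h' : p = p'
          · subst h'; exact ⟨i, hd⟩
          · rw [e] at hb; simp [h', hb'] at hb
        · rw [e] at hb
          by_cases h' : p = p'
          · subst h'; simp at hb
          · simp [h', hb'] at hb
        · by_cases h' : p = p'
          · subst h'; rw [hb'] at hp; simp at hp
          · rw [e] at hb; simp [h', hb'] at hb
      obtain ⟨i, hi⟩ := hcall
      refine ⟨b, i, b.lt_succ_self, hi, hb', fun k h1 h2 => ?_⟩
      obtain rfl : k = b + 1 := by omega
      rwa [run]

/-- A process that takes infinitely many steps does not run forever. -/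
theorem WaitFree.exists_not_running (hA : A.WaitFree) {d : ℕ → A.Decision} {N : ℕ} {p : Fin n}
    (hd : ∀ k, ∃ l, k ≤ l ∧ d l = some (p, none)) :
    ∃ k, N ≤ k ∧ ((A.run d k).1 p).2 = false := by
  by_contra! hrun
  have hrun' : ∀ k, N ≤ k → ((A.run d k).1 p).2 = true := fun k hk => by simpa using hrun k hk
  obtain ⟨a, i, haN, ha, ha', har⟩ := exists_call (hrun' N le_rfl)
  have hinf : {k | ∃ x, A.trace d k = some (p, x)}.Infinite := by
    refine Set.infinite_of_forall_exists_gt fun k => ?_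
    obtain ⟨l, hl, hdl⟩ := hd (N + k + 1)
    refine ⟨2 * l, ?_, by omega⟩
    have hl' := hrun' l (by omega)
    rw [Set.mem_ofPred_eq, trace_even, hdl]
    rcases hn : A.next p ((A.run d l).1 p).1 with y | v <;> simp [exec, hl', hn]
  obtain ⟨m, v, p', i', hi, hlt, hr, -⟩ := hA _ (isExecution_trace d) p hinf (2 * a) i
    (invoked_trace_iff.2 ⟨a, rfl, ha, ha'⟩)
  obtain ⟨k, hk, h1, h2, h3⟩ := response_trace_iff.1 hr
  obtain ⟨a', ha2, h4, -⟩ := invoked_trace_iff.1 hi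
  obtain rfl : a = a' := by omega
  rw [ha] at h4
  simp only [Option.some.injEq, Prod.mk.injEq] at h4
  obtain ⟨rfl, -⟩ := h4
  -- The response comes after the call at `a`, and `p` has been assumed to run at all later
  -- instants; but a return makes it idle.
  have h5 : ((A.run d (k + 1)).1 p).2 = true := by
    rcases le_total (k + 1) N with h | h
    · exact har _ (by omega) h
    · exact hrun' _ h
  rw [run, h1, exec_ret h2 h3] at h5
  simp at h5

/-! ### Solo runs -/

/-- The part of the system that matters for a solo run of `p`. -/
abbrev view (p : Fin n) (g : A.Sys) : A.Loc × A.Memory := ((g.1 p).1, g.2)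

/-- The effect of an access by `p` on its local state and on the memory. -/
noncomputable def soloStep (p : Fin n) (s : A.Loc × A.Memory) : A.Loc × A.Memory :=
  match A.next p s.1 with
  | .inl y => (A.onReply p s.1 (access s.2 y).1, (access s.2 y).2)
  | .inr _ => s

theorem soloStep_of_inl {p : Fin n} {s : A.Loc × A.Memory} {y : A.Access}
    (h : A.next p s.1 = .inl y) :
    soloStep p s = (A.onReply p s.1 (access s.2 y).1, (access s.2 y).2) := by
  simp only [soloStep, h]

theorem soloStep_of_inr {p : Fin n} {s : A.Loc × A.Memory} {v : O.Res}
    (h : A.next p s.1 = .inr v) : soloStep p s = s := by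
  simp only [soloStep, h]

/-- If `p` runs alone, then it returns `v`. -/
def SoloReturns (p : Fin n) (s : A.Loc × A.Memory) (v : O.Res) : Prop :=
  ∃ k, A.next p ((soloStep p)^[k] s).1 = .inr v

/-- A process does not change its solo outcome by its own steps; only steps of the others can. If
the return is already reached, `soloStep` does nothing. -/
theorem soloReturns_soloStep {p : Fin n} {s : A.Loc × A.Memory} {v : O.Res} :
    SoloReturns p (soloStep p s) v ↔ SoloReturns p s v := by
  constructor
  · rintro ⟨k, hk⟩
    exact ⟨k + 1, by rwa [Function.iterate_succ_apply]⟩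
  · rintro ⟨k, hk⟩
    refine ⟨k, ?_⟩
    rw [← Function.iterate_succ_apply, Function.iterate_succ_apply', soloStep_of_inr hk, hk]

theorem iterate_soloStep {p : Fin n} {s : A.Loc × A.Memory} {v : O.Res} {k l : ℕ}
    (h : A.next p ((soloStep p)^[k] s).1 = .inr v) (hkl : k ≤ l) :
    (soloStep p)^[l] s = (soloStep p)^[k] s := by
  induction l, hkl using Nat.le_induction with
  | base => rfl
  | succ l _ ih => rw [Function.iterate_succ_apply', ih, soloStep_of_inr h]

theorem SoloReturns.unique {p : Fin n} {s : A.Loc × A.Memory} {v w : O.Res}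
    (hv : SoloReturns p s v) (hw : SoloReturns p s w) : v = w := by
  obtain ⟨k, hk⟩ := hv
  obtain ⟨l, hl⟩ := hw
  rw [← iterate_soloStep hk (le_max_left k l)] at hk
  rw [← iterate_soloStep hl (le_max_right k l), hk] at hl
  exact Sum.inr_injective hl

theorem soloReturns_of_next {p : Fin n} {s : A.Loc × A.Memory} {v : O.Res}
    (h : A.next p s.1 = .inr v) : SoloReturns p s v := ⟨0, h⟩

/-- `soloStep` stalls at a return whereas `exec` ends the operation, so the two are compared only
before the first return. -/
theorem run_solo {d : ℕ → A.Decision} {K j : ℕ} {p : Fin n}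
    (hp : ((A.run d K).1 p).2 = true) (hd : ∀ k, K ≤ k → k < K + j → d k = some (p, none))
    (hn : ∀ k < j, ∀ v, A.next p ((soloStep p)^[k] (view p (A.run d K))).1 ≠ .inr v) :
    A.run d (K + j) =
      (Function.update (A.run d K).1 p (((soloStep p)^[j] (view p (A.run d K))).1, true),
        ((soloStep p)^[j] (view p (A.run d K))).2) := by
  induction j with
  | zero =>
    simp [view, ← hp]
  | succ j ih =>
    have ih' := ih (fun k h1 h2 => hd k h1 (by omega)) fun k hk => hn k (by omega)
    rw [← add_assoc, run, hd (K + j) (by omega) (by omega), ih', Function.iterate_succ_apply']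
    rcases hy : A.next p ((soloStep p)^[j] (view p (A.run d K))).1 with y | v
    · rw [exec_access (y := y) (by simp) (by simpa using hy), soloStep_of_inl hy]
      simp
    · exact absurd hy (hn j (by omega) v)

/-- A running process is able to finish its operation alone. -/
theorem WaitFree.exists_solo_run (hA : A.WaitFree) {d : ℕ → A.Decision} {K : ℕ} {p : Fin n}
    (hp : ((A.run d K).1 p).2 = true) :
    ∃ (d' : ℕ → A.Decision) (j : ℕ) (v : O.Res), (∀ k < K, d' k = d k) ∧
      (∀ k, K ≤ k → d' k = some (p, none)) ∧ SoloReturns p (view p (A.run d K)) v ∧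
      A.next p ((A.run d' (K + j)).1 p).1 = .inr v ∧
      (∀ k, K ≤ k → k ≤ K + j → ((A.run d' k).1 p).2 = true) ∧
      ((A.run d' (K + j + 1)).1 p).2 = false ∧
      ∀ q, q ≠ p → (A.run d' (K + j + 1)).1 q = (A.run d K).1 q := by
  classical
  let d' : ℕ → A.Decision := fun k => if k < K then d k else some (p, none)
  have hlt : ∀ k < K, d' k = d k := fun k hk => if_pos hk
  have hge : ∀ k, K ≤ k → d' k = some (p, none) := fun k hk => if_neg (by omega)
  have hK : A.run d' K = A.run d K := run_congr hlt le_rfl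
  rw [← hK] at hp
  have hex : ∃ j v, A.next p ((soloStep p)^[j] (view p (A.run d' K))).1 = .inr v := by
    by_contra! h
    obtain ⟨k, hk, hk'⟩ := hA.exists_not_running (d := d') (N := K) (p := p)
      fun k => ⟨K + k, by omega, hge _ (by omega)⟩
    obtain ⟨j, rfl⟩ := Nat.exists_eq_add_of_le hk
    rw [run_solo hp (fun k h _ => hge k h) fun k _ => h k] at hk'
    simp at hk'
  obtain ⟨v, hv⟩ := Nat.find_spec hex
  have hrun : ∀ i ≤ Nat.find hex, A.run d' (K + i) = _ := fun i hi =>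
    run_solo hp (fun k h _ => hge k h) fun k hk w hw =>
      Nat.find_min hex (hk.trans_le hi) ⟨w, hw⟩
  have hj := hrun _ le_rfl
  have hnext : A.next p ((A.run d' (K + Nat.find hex)).1 p).1 = .inr v := by
    rw [hj]; simpa using hv
  have htrue : ∀ k, K ≤ k → k ≤ K + Nat.find hex → ((A.run d' k).1 p).2 = true := by
    intro k h1 h2
    obtain ⟨i, rfl⟩ := Nat.exists_eq_add_of_le h1
    rw [hrun i (by omega)]
    simp
  have hlast : A.run d' (K + Nat.find hex + 1) =
      (exec (A.run d' (K + Nat.find hex)) (some (p, none))).1 := by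
    rw [run, hge _ (by omega)]
  rw [exec_ret (htrue _ (by omega) le_rfl) hnext] at hlast
  refine ⟨d', Nat.find hex, v, hlt, hge, ?_, hnext, htrue, ?_, fun q hq => ?_⟩
  · rw [← hK]; exact ⟨_, hv⟩
  · rw [hlast]; simp
  · rw [hlast, hj, ← hK]; simp [hq]

end Schedules
end Implementation

/-! ### Quiescent schedules. -/

namespace Implementation

section Quiescence

variable {T O : DataType} {n : ℕ} {A : Implementation T O n}

/-- No process performs an operation after the first `N` decisions. -/
def Quiescent (A : Implementation T O n) (d : ℕ → A.Decision) (N : ℕ) : Prop :=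
  ∀ p, ((A.run d N).1 p).2 = false

theorem history_trace_congr {d d' : ℕ → A.Decision} {N : ℕ} (h : ∀ k < N, d k = d' k) :
    ∀ j < 2 * N, A.history (A.trace d) j = A.history (A.trace d') j := by
  intro j hj
  simp only [history, trace_congr h hj]

theorem Quiescent.congr {d d' : ℕ → A.Decision} {N : ℕ} (h : ∀ k < N, d k = d' k)
    (hN : A.Quiescent d N) : A.Quiescent d' N := by
  unfold Quiescent
  rw [← run_congr h le_rfl]
  exact hN

theorem Quiescent.exists_returns {d : ℕ → A.Decision} {N o : ℕ} {p : Fin n} {i : O.Inv}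
    (hN : A.Quiescent d N) (ho : (A.history (A.trace d)).Invoked o p i) (hoN : o < 2 * N) :
    ∃ m v, m < 2 * N ∧ (A.history (A.trace d)).Returns o m v := by
  obtain ⟨a, rfl, ha, ha'⟩ := invoked_trace_iff.1 ho
  have h1 : ((A.run d (a + 1)).1 p).2 = true := by
    rw [run, ha, exec_call i ha']; simp
  have hne : a + 1 ≠ N := by
    rintro rfl
    rw [hN p] at h1
    simp at h1
  obtain ⟨k, v, hk1, hk2, hrun, hd, hn⟩ := exists_return (by omega : a + 1 < N) h1 (hN p)
  exact ⟨2 * k, v, by omega, returns_trace (by omega) ha ha' (fun l h h' => hrun l h h') hd hn⟩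

theorem run_succ_of_ne {d : ℕ → A.Decision} {k : ℕ} {r : Fin n} (h : ∀ i, d k ≠ some (r, i)) :
    (A.run d (k + 1)).1 r = (A.run d k).1 r := by
  rw [run]
  rcases hd : d k with _ | ⟨p, i⟩
  · rfl
  · refine exec_of_ne ?_ i
    rintro rfl
    exact h i hd

theorem run_of_ne {d : ℕ → A.Decision} {a b : ℕ} {r : Fin n} (hab : a ≤ b)
    (h : ∀ k, a ≤ k → k < b → ∀ i, d k ≠ some (r, i)) :
    (A.run d b).1 r = (A.run d a).1 r := by
  induction b, hab using Nat.le_induction with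
  | base => rfl
  | succ b hb ih =>
    rw [run_succ_of_ne (h b hb b.lt_succ_self), ih fun k h1 h2 => h k h1 (by omega)]

end Quiescence

/-! ### Stabilization, and two competing fetch-and-cons operations. -/

section Fac

variable {T : DataType} {V : Type} [Primcodable V] {n : ℕ} {A : Implementation T (facType V) n}

/-- An eventually linearizable implementation of a fetch-and-cons object has a quiescent execution
after which the object behaves correctly as far as the lengths of the lists are concerned. -/
theorem IsEventuallyLinearizable.exists_forall_fitsBetween (hA : A.IsEventuallyLinearizable) :
    ∃ d N, A.Quiescent d N ∧ ∀ d' N', (∀ k < N, d' k = d k) → A.Quiescent d' N' →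
      (∃ k p i, N ≤ k ∧ k < N' ∧ (A.history (A.trace d')).Invoked (2 * k) p i) →
      (A.history (A.trace d')).FitsBetween (2 * N) (2 * N') := by
  by_contra! h
  obtain ⟨d, N, hN, hdN⟩ : ∃ (d : ℕ → A.Decision) (N : ℕ → ℕ), StrictMono N ∧
      ∀ j, A.Quiescent d (N j) ∧ (∃ k p i, N j ≤ k ∧ k < N (j + 1) ∧
        (A.history (A.trace d)).Invoked (2 * k) p i) ∧
        ¬ (A.history (A.trace d)).FitsBetween (2 * N j) (2 * N (j + 1)) := by
    -- Each extension is a counterexample to the claim. The invocation required in it makes the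
    -- schedule strictly longer and supplies the operation per block that `exists_fitsBetween`
    -- needs.
    refine exists_limit_of_extension (P := A.Quiescent)
      (R := fun d M N => (∃ k p i, M ≤ k ∧ k < N ∧ (A.history (A.trace d)).Invoked (2 * k) p i) ∧
        ¬ (A.history (A.trace d)).FitsBetween (2 * M) (2 * N))
      (fun d d' N hd h => h.congr hd) ?_ (d₀ := fun _ => none) (N₀ := 0) (fun p => rfl) ?_
    · rintro d d' M N hd hlt ⟨⟨k, p, i, h1, h2, h3⟩, h4⟩
      have hh := history_trace_congr hd
      refine ⟨⟨k, p, i, h1, h2, ?_⟩,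
        fun h5 => h4 (h5.congr (by omega) fun j hj => (hh j hj).symm)⟩
      rw [History.Invoked, ← hh _ (by omega)]
      exact h3
    · intro d N hN
      obtain ⟨d', N', h1, h2, ⟨k, p, i, h3, h4, h5⟩, h6⟩ := h d N hN
      exact ⟨d', N', by omega, h1, h2, ⟨k, p, i, h3, h4, h5⟩, h6⟩
  obtain ⟨-, -, t, ht⟩ := hA _ (isExecution_trace d)
  have hb : StrictMono fun j => 2 * N j := fun i j hij => by
    have := hN hij
    simp only
    omega
  obtain ⟨j, hj⟩ := exists_fitsBetween ht hb
    (fun j o p i ho hlt => (hdN j).1.exists_returns ho hlt) fun j => by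
      obtain ⟨k, p, i, h1, h2, h3⟩ := (hdN j).2.1
      exact ⟨2 * k, p, i, by omega, by omega, h3⟩
  exact (hdN j).2.2 hj

/-- After `N` decisions of `d₀` only `p` and `q` are scheduled; they invoke one operation each, at
the instants `a` and `b`, and both operations are pending until `K`. -/
structure Duel (d₀ : ℕ → A.Decision) (N : ℕ) (p q : Fin n) (x : V) (a b : ℕ)
    (d : ℕ → A.Decision) (K : ℕ) : Prop where
  le : N + 2 ≤ K
  agree : ∀ k < N, d k = d₀ k
  instants : (a = N ∧ b = N + 1) ∨ (a = N + 1 ∧ b = N)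
  call_left : d a = some (p, some x)
  call_right : d b = some (q, some x)
  steps : ∀ k, N + 2 ≤ k → k < K → d k = some (p, none) ∨ d k = some (q, none)
  running : ∀ k, N + 2 ≤ k → k ≤ K → ((A.run d k).1 p).2 = true ∧ ((A.run d k).1 q).2 = true

namespace Duel

variable {d₀ d d' : ℕ → A.Decision} {N K a b : ℕ} {p q : Fin n} {x : V}

/-- Leaving the order of the two calls open in `instants` makes the roles of `p` and `q`
interchangeable, so each later fact is needed for `p` only. -/
theorem symm (h : Duel d₀ N p q x a b d K) : Duel d₀ N q p x b a d K where
  le := h.le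
  agree := h.agree
  instants := h.instants.symm.imp (fun h => ⟨h.2, h.1⟩) fun h => ⟨h.2, h.1⟩
  call_left := h.call_right
  call_right := h.call_left
  steps k h1 h2 := (h.steps k h1 h2).symm
  running k h1 h2 := (h.running k h1 h2).symm

theorem congr (hd : ∀ k < K, d k = d' k) (h : Duel d₀ N p q x a b d K) :
    Duel d₀ N p q x a b d' K where
  le := h.le
  agree k hk := (hd k (by have := h.le; omega)).symm.trans (h.agree k hk)
  instants := h.instants
  call_left := (hd a (by have := h.le; have := h.instants; omega)).symm.trans h.call_left
  call_right := (hd b (by have := h.le; have := h.instants; omega)).symm.trans h.call_right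
  steps k h1 h2 := by rw [← hd k h2]; exact h.steps k h1 h2
  running k h1 h2 := by rw [← run_congr hd h2]; exact h.running k h1 h2

theorem not_running (hpq : p ≠ q) (hN : A.Quiescent d₀ N) (h : Duel d₀ N p q x a b d K) :
    ((A.run d a).1 p).2 = false := by
  have h1 : A.Quiescent d N := hN.congr fun k hk => (h.agree k hk).symm
  rcases h.instants with ⟨rfl, -⟩ | ⟨rfl, rfl⟩
  · exact h1 p
  · rw [run_succ_of_ne, h1 p]
    intro i hi
    rw [h.call_right] at hi
    simp only [Option.some.injEq, Prod.mk.injEq] at hi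
    exact hpq hi.1.symm

theorem running_left (hpq : p ≠ q) (hN : A.Quiescent d₀ N) (h : Duel d₀ N p q x a b d K) {k : ℕ}
    (hk : a < k) (hkK : k ≤ K) : ((A.run d k).1 p).2 = true := by
  by_cases hk' : N + 2 ≤ k
  · exact (h.running k hk' hkK).1
  · have := h.instants
    obtain rfl : k = a + 1 := by omega
    rw [run, h.call_left, exec_call x (h.not_running hpq hN)]
    simp

/-- Exactly one of the two operations takes effect first. -/
theorem length_eq_iff (hA : A.WaitFree) (hpq : p ≠ q) (hN : A.Quiescent d₀ N)
    (hfit : ∀ d' N', (∀ k < N, d' k = d₀ k) → A.Quiescent d' N' →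
      (∃ k p i, N ≤ k ∧ k < N' ∧ (A.history (A.trace d')).Invoked (2 * k) p i) →
      (A.history (A.trace d')).FitsBetween (2 * N) (2 * N'))
    (h : Duel d₀ N p q x a b d K) {v w : List V}
    (hv : A.next p ((A.run d K).1 p).1 = .inr v) (hw : SoloReturns q (view q (A.run d K)) w) :
    (v.length = (A.history (A.trace d₀)).invCount (2 * N) ↔
      w.length ≠ (A.history (A.trace d₀)).invCount (2 * N)) := by
  classical
  have hle := h.le
  -- Here `p` returns at `K`, which does not touch the memory; `d₂` then lets `q` finish alone, with
  -- the same outcome as from `K`. The result is quiescent.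
  let d₁ : ℕ → A.Decision := fun k => if k < K then d k else some (p, none)
  have hd₁ : ∀ k < K, d k = d₁ k := fun k hk => (if_pos hk).symm
  have hd₁K : d₁ K = some (p, none) := if_neg (by omega)
  have hrun₁ : A.run d₁ K = A.run d K := (run_congr hd₁ le_rfl).symm
  have hK := h.running K hle le_rfl
  have hret : A.run d₁ (K + 1) = (Function.update (A.run d K).1 p (((A.run d K).1 p).1, false),
      (A.run d K).2) := by
    rw [run, hd₁K, hrun₁, exec_ret hK.1 hv]
  have hq₁ : (A.run d₁ (K + 1)).1 q = (A.run d K).1 q := by rw [hret]; simp [hpq.symm]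
  have hview : view q (A.run d₁ (K + 1)) = view q (A.run d K) := by
    simp [view, hret, hpq.symm]
  obtain ⟨d₂, j, w', hagree, hge, hsolo, hnext, htrue, hfalse, hother⟩ :=
    hA.exists_solo_run (d := d₁) (K := K + 1) (p := q) (by rw [hq₁]; exact hK.2)
  rw [hview] at hsolo
  obtain rfl := hw.unique hsolo
  have hd₂ : ∀ k < K, d k = d₂ k := fun k hk =>
    (hd₁ k hk).trans (hagree k (by omega)).symm
  have h₂ : Duel d₀ N p q x a b d₂ K := h.congr hd₂
  have hd₂K : d₂ K = some (p, none) := (hagree K (by omega)).trans hd₁K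
  have hrun₂ : A.run d₂ K = A.run d K := (run_congr hd₂ le_rfl).symm
  have hins := h.instants
  have hretp : (A.history (A.trace d₂)).Returns (2 * a) (2 * K) v :=
    returns_trace (by omega) h₂.call_left (h₂.not_running hpq hN)
      (fun k h1 h2 => h₂.running_left hpq hN h1 h2) hd₂K (by rw [hrun₂]; exact hv)
  have hretq : (A.history (A.trace d₂)).Returns (2 * b) (2 * (K + 1 + j)) w := by
    refine returns_trace (by omega) h₂.call_right (h₂.symm.not_running hpq.symm hN) ?_
      (hge _ (by omega)) hnext
    intro k h1 h2
    by_cases h3 : k ≤ K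
    · exact h₂.symm.running_left hpq.symm hN h1 h3
    · exact htrue k (by omega) h2
  have hquiet : A.Quiescent d₂ (K + 1 + j + 1) := by
    intro r
    rcases eq_or_ne r q with rfl | hrq
    · exact hfalse
    · rw [hother r hrq, hret]
      rcases eq_or_ne r p with rfl | hrp
      · simp
      · simp only [Function.update_of_ne hrp]
        rw [run_of_ne (a := N) (by omega), run_congr h.agree le_rfl]
        · exact hN r
        · intro k h1 h2 i hi
          have hr : d k ≠ some (r, i) := by
            by_cases h3 : N + 2 ≤ k
            · rcases h.steps k h3 h2 with e | e <;> rw [e] <;> simp [hrp.symm, hrq.symm]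
            · have hk : k = a ∨ k = b := by omega
              rcases hk with rfl | rfl
              · rw [h.call_left]; simp [hrp.symm]
              · rw [h.call_right]; simp [hrq.symm]
          exact hr hi
  have hinvp : (A.history (A.trace d₂)).Invoked (2 * a) p x :=
    invoked_trace_iff.2 ⟨a, rfl, h₂.call_left, h₂.not_running hpq hN⟩
  have hfits := hfit d₂ _ h₂.agree hquiet ⟨a, p, x, by omega, by omega, hinvp⟩
  have hcount : (A.history (A.trace d₂)).invCount (2 * (K + 1 + j + 1)) ≤
      (A.history (A.trace d₂)).invCount (2 * N) + ({2 * a, 2 * b} : Finset ℕ).card := by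
    refine History.invCount_le_add_card _ fun l r i h1 h2 h3 => ?_
    obtain ⟨k, rfl, hk, -⟩ := invoked_trace_iff.1 h3
    by_cases h4 : N + 2 ≤ k
    · by_cases h5 : k < K
      · rcases h₂.steps k h4 h5 with e | e <;> rw [e] at hk <;> simp at hk
      · by_cases h6 : k = K
        · rw [h6, hd₂K] at hk; simp at hk
        · rw [hge k (by omega)] at hk; simp at hk
    · rw [Finset.mem_insert, Finset.mem_singleton]
      omega
  have hcard : ({2 * a, 2 * b} : Finset ℕ).card ≤ 2 := Finset.card_le_two
  have hcount₀ : (A.history (A.trace d₂)).invCount (2 * N) =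
      (A.history (A.trace d₀)).invCount (2 * N) :=
    History.invCount_congr (history_trace_congr h₂.agree)
  -- With at most two new operations, both lengths lie in `{c, c + 1}`, where `c` counts the
  -- operations before the duel; as they differ, exactly one equals `c`.
  have h1 := hfits.1 _ _ _ (by omega) (by omega) hretp
  have h2 := hfits.1 _ _ _ (by omega) (by omega) hretq
  have h3 := hfits.2 _ _ _ _ _ _ (by omega) (by omega) (by omega) (by omega) (by omega) hretp hretq
  omega

end Duel

/-- An operation that is performed alone returns the list of all operations performed before. -/
theorem WaitFree.exists_soloReturns_length (hA : A.WaitFree) {d₀ : ℕ → A.Decision} {N : ℕ}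
    (hN : A.Quiescent d₀ N)
    (hfit : ∀ d' N', (∀ k < N, d' k = d₀ k) → A.Quiescent d' N' →
      (∃ k p i, N ≤ k ∧ k < N' ∧ (A.history (A.trace d')).Invoked (2 * k) p i) →
      (A.history (A.trace d')).FitsBetween (2 * N) (2 * N')) (p : Fin n) (x : V) :
    ∃ v, SoloReturns p (A.onCall p ((A.run d₀ N).1 p).1 x, (A.run d₀ N).2) v ∧
      v.length = (A.history (A.trace d₀)).invCount (2 * N) := by
  let d₁ : ℕ → A.Decision := fun k => if k < N then d₀ k else some (p, some x)
  have hd₁ : ∀ k < N, d₁ k = d₀ k := fun k hk => if_pos hk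
  have hd₁N : d₁ N = some (p, some x) := if_neg (by omega)
  have hrun₁ : A.run d₁ (N + 1) =
      (Function.update (A.run d₀ N).1 p (A.onCall p ((A.run d₀ N).1 p).1 x, true),
        (A.run d₀ N).2) := by
    rw [run, hd₁N, run_congr hd₁ le_rfl, exec_call x (hN p)]
  obtain ⟨d₂, j, v, hagree, hge, hsolo, hnext, htrue, hfalse, hother⟩ :=
    hA.exists_solo_run (d := d₁) (K := N + 1) (p := p) (by rw [hrun₁]; simp)
  have hd₂ : ∀ k < N, d₂ k = d₀ k := fun k hk => (hagree k (by omega)).trans (hd₁ k hk)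
  have hd₂N : d₂ N = some (p, some x) := (hagree N (by omega)).trans hd₁N
  have hidle : ((A.run d₂ N).1 p).2 = false := by rw [run_congr hd₂ le_rfl]; exact hN p
  refine ⟨v, by simpa [view, hrun₁] using hsolo, ?_⟩
  have hret : (A.history (A.trace d₂)).Returns (2 * N) (2 * (N + 1 + j)) v :=
    returns_trace (by omega) hd₂N hidle (fun k h1 h2 => htrue k h1 h2) (hge _ (by omega)) hnext
  have hquiet : A.Quiescent d₂ (N + 1 + j + 1) := by
    intro r
    rcases eq_or_ne r p with rfl | hrp
    · exact hfalse
    · rw [hother r hrp, hrun₁]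
      simp only [Function.update_of_ne hrp]
      exact hN r
  have hfits := hfit d₂ _ hd₂ hquiet
    ⟨N, p, x, le_rfl, by omega, invoked_trace_iff.2 ⟨N, rfl, hd₂N, hidle⟩⟩
  have hcount : (A.history (A.trace d₂)).invCount (2 * (N + 1 + j + 1)) ≤
      (A.history (A.trace d₂)).invCount (2 * N) + ({2 * N} : Finset ℕ).card := by
    refine History.invCount_le_add_card _ fun l r i h1 h2 h3 => ?_
    obtain ⟨k, rfl, hk, -⟩ := invoked_trace_iff.1 h3
    rw [Finset.mem_singleton]
    by_contra h4
    rw [hge k (by omega)] at hk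
    simp at hk
  rw [Finset.card_singleton] at hcount
  have hcount₀ : (A.history (A.trace d₂)).invCount (2 * N) =
      (A.history (A.trace d₀)).invCount (2 * N) :=
    History.invCount_congr (history_trace_congr hd₂)
  have h1 := hfits.1 _ _ _ le_rfl (by omega) hret
  omega

end Fac

end Implementation

/-! ### The valency argument for registers. -/

namespace Implementation

section Registers

variable {X : Type} [Primcodable X] {O : DataType} {n : ℕ} {A : Implementation (registerType X) O n}

/-- Two accesses to registers: one of them is a read, or the first is a write that is not noticed
after the second or commutes with it. -/
theorem access_cases (x y : A.Access) :
    (∀ m, (access m x).2 = m) ∨ (∀ m, (access m y).2 = m) ∨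
    ((∀ m m', (access m x).1 = (access m' x).1) ∧
      ((∀ m, (access (access m y).2 x).2 = (access m x).2) ∨
        ∀ m, (access (access m x).2 y).2 = (access (access m y).2 x).2)) := by
  classical
  rcases x with ⟨a, _ | i⟩ | ⟨a, _ | i⟩
  · left; intro m; simp [access]
  · rcases y with ⟨b, _ | j⟩ | ⟨b, _ | j⟩
    · right; left; intro m; simp [access]
    · right; right
      refine ⟨fun _ _ => rfl, ?_⟩
      by_cases hab : a = b
      · subst hab; left; intro m; simp [access]
      · right; intro m
        simp only [access, Prod.mk.injEq, and_true]
        exact Function.update_comm hab _ _ _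
    · right; left; intro m; simp [access]
    · right; right
      exact ⟨fun _ _ => rfl, Or.inr fun m => rfl⟩
  · left; intro m; simp [access]
  · rcases y with ⟨b, _ | j⟩ | ⟨b, _ | j⟩
    · right; left; intro m; simp [access]
    · right; right
      exact ⟨fun _ _ => rfl, Or.inr fun m => rfl⟩
    · right; left; intro m; simp [access]
    · right; right
      refine ⟨fun _ _ => rfl, ?_⟩
      by_cases hab : a = b
      · subst hab; left; intro m; simp [access]
      · right; intro m
        simp only [access, Prod.mk.injEq, true_and]
        exact Function.update_comm hab _ _ _

/-- The solo runs of `p` and `q` both have, or both do not have, a result that satisfies `W`. -/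
def Balanced (W : O.Res → Prop) (p q : Fin n) (g : A.Sys) : Prop :=
  (∃ v, SoloReturns p (view p g) v ∧ W v) ↔ ∃ v, SoloReturns q (view q g) v ∧ W v

/-- A step of one process keeps its own solo outcome, so balance can be lost only through what the
other process notices in the memory. The property of registers that is used is `access_cases`. -/
theorem Balanced.step {W : O.Res → Prop} {p q : Fin n} (hpq : p ≠ q) {g : A.Sys}
    (hg : Balanced W p q g) (hp : (g.1 p).2 = true) (hq : (g.1 q).2 = true) {x y : A.Access}
    (hx : A.next p (g.1 p).1 = .inl x) (hy : A.next q (g.1 q).1 = .inl y) :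
    Balanced W p q (exec g (some (p, none))).1 ∨ Balanced W p q (exec g (some (q, none))).1 ∨
      Balanced W p q (exec (exec g (some (p, none))).1 (some (q, none))).1 := by
  have ep := exec_access hp hx
  have eq := exec_access hq hy
  have epq : (exec (exec g (some (p, none))).1 (some (q, none))).1 = _ :=
    exec_access (y := y) (by rw [ep]; simp [hpq.symm, hq]) (by rw [ep]; simpa [hpq.symm] using hy)
  have vpp : view p (exec g (some (p, none))).1 = soloStep p (view p g) := by
    rw [soloStep_of_inl hx, ep]; simp [view]
  have vqq : view q (exec g (some (q, none))).1 = soloStep q (view q g) := by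
    rw [soloStep_of_inl hy, eq]; simp [view]
  have vqp : view q (exec g (some (p, none))).1 = ((g.1 q).1, (access g.2 x).2) := by
    rw [ep]; simp [view, hpq.symm]
  have vpq : view p (exec g (some (q, none))).1 = ((g.1 p).1, (access g.2 y).2) := by
    rw [eq]; simp [view, hpq]
  have spq : soloStep p ((g.1 p).1, (access g.2 y).2) =
      (A.onReply p (g.1 p).1 (access (access g.2 y).2 x).1, (access (access g.2 y).2 x).2) :=
    soloStep_of_inl hx
  unfold Balanced at hg ⊢
  rw [vpp, vqp, vqq, vpq]
  simp only [soloReturns_soloStep]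
  rcases access_cases x y with h | h | ⟨hrep, h | h⟩
  · left; rw [h]; exact hg
  -- An access that leaves the memory unchanged is invisible to the other process.
  · right; left; rw [h]; exact hg
  · right; left
    -- The next access of `p` erases the effect of `q`'s write, so `p` runs alone as if `q` had not
    -- moved.
    have : ∀ v, SoloReturns p ((g.1 p).1, (access g.2 y).2) v ↔ SoloReturns p (view p g) v := by
      intro v
      rw [← soloReturns_soloStep, spq, h, hrep _ g.2, ← soloReturns_soloStep (s := view p g),
        soloStep_of_inl hx]
    simp only [this]
    exact hg
  -- For commuting writes, after both steps the outcome of `q` is the one it has after the step of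
  -- `p` alone, and vice versa.
  · have v₁ : view q (exec (exec g (some (p, none))).1 (some (q, none))).1 =
        soloStep q ((g.1 q).1, (access g.2 x).2) := by
      rw [soloStep_of_inl (y := y) hy, epq, ep]; simp [view, hpq.symm]
    have v₂ : view p (exec (exec g (some (p, none))).1 (some (q, none))).1 =
        soloStep p ((g.1 p).1, (access g.2 y).2) := by
      rw [spq, epq, ep, ← h, hrep (access g.2 y).2 g.2]; simp [view, hpq]
    rw [v₁, v₂]
    simp only [soloReturns_soloStep]
    -- Here `a`, `b` are the outcomes of `p`, `q` in `g`, `c` is that of `q` after a step of `p`,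
    -- and `d` that of `p` after a step of `q`. If neither single step is balanced, both `c` and `d`
    -- are opposite to the common value of `a` and `b`, hence equal.
    have hprop : ∀ a b c d : Prop, (a ↔ b) → ((a ↔ c) ∨ (d ↔ b) ∨ (d ↔ c)) := by grind
    exact hprop _ _ _ _ hg

end Registers

/-- Registers do not implement an eventually linearizable fetch-and-cons object for two
processes. -/
theorem not_waitFree_of_isEventuallyLinearizable {X V : Type} [Primcodable X] [Primcodable V]
    [Nonempty V] {n : ℕ} (hn : 2 ≤ n) {A : Implementation (registerType X) (facType V) n}
    (hA : A.IsEventuallyLinearizable) : ¬ A.WaitFree := by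
  intro hwf
  obtain ⟨x⟩ := ‹Nonempty V›
  obtain ⟨p, q, hpq⟩ : ∃ p q : Fin n, p ≠ q :=
    ⟨⟨0, by omega⟩, ⟨1, by omega⟩, by simp [Fin.ext_iff]⟩
  obtain ⟨d₀, N, hN, hfit⟩ := hA.exists_forall_fitsBetween
  -- `W` singles out the operation that takes effect first after the quiescent point.
  let W : List V → Prop := fun v => v.length = (A.history (A.trace d₀)).invCount (2 * N)
  let P : (ℕ → A.Decision) → ℕ → Prop := fun d K =>
    Duel d₀ N p q x N (N + 1) d K ∧ Balanced (O := facType V) W p q (A.run d K)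
  obtain ⟨d, L, hL, hd⟩ : ∃ (d : ℕ → A.Decision) (L : ℕ → ℕ), StrictMono L ∧
      ∀ j, P d (L j) ∧ True := by
    refine exists_limit_of_extension (P := P) (R := fun _ _ _ => True) (d₀ := fun k =>
      if k < N then d₀ k else if k = N then some (p, some x) else some (q, some x))
      (N₀ := N + 2) ?_ (fun _ _ _ _ _ _ h => h) ?_ ?_
    · rintro d d' K hK ⟨h1, h2⟩
      exact ⟨h1.congr hK, by rw [← run_congr hK le_rfl]; exact h2⟩
    · set d : ℕ → A.Decision :=
        fun k => if k < N then d₀ k else if k = N then some (p, some x) else some (q, some x) with hd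
      have hag : ∀ k < N, d k = d₀ k := fun k hk => if_pos hk
      have hdN : d N = some (p, some x) := by simp [hd]
      have hdN' : d (N + 1) = some (q, some x) := by simp [hd]
      have hrun₀ : A.run d N = A.run d₀ N := run_congr hag le_rfl
      have hrun₁ : A.run d (N + 1) = (Function.update (A.run d₀ N).1 p
          (A.onCall p ((A.run d₀ N).1 p).1 x, true), (A.run d₀ N).2) := by
        rw [run, hdN, hrun₀, exec_call x (hN p)]
      have hrun₂ : A.run d (N + 2) = (Function.update (A.run d (N + 1)).1 q
          (A.onCall q ((A.run d₀ N).1 q).1 x, true), (A.run d₀ N).2) := by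
        have hq : (A.run d (N + 1)).1 q = (A.run d₀ N).1 q := by rw [hrun₁]; simp [hpq.symm]
        rw [run, hdN', exec_call (A := A) (g := A.run d (N + 1)) x (by rw [hq]; exact hN q), hq]
        simp [hrun₁]
      refine ⟨⟨le_rfl, hag, Or.inl ⟨rfl, rfl⟩, hdN, hdN', fun k h1 h2 => by omega, ?_⟩, ?_⟩
      · intro k h1 h2
        obtain rfl : k = N + 2 := by omega
        rw [hrun₂, hrun₁]
        simp [hpq]
      · have hp := hwf.exists_soloReturns_length hN hfit p x
        have hq := hwf.exists_soloReturns_length hN hfit q x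
        -- Calls do not touch the memory, so each process, run alone now, behaves as if the other
        -- had not been called, and wins.
        refine iff_of_true ?_ ?_
        · rw [hrun₂, hrun₁]; simpa [view, hpq] using hp
        · rw [hrun₂, hrun₁]; simpa [view] using hq
    · rintro d K ⟨hduel, hbal⟩
      obtain ⟨hp, hq⟩ := hduel.running K hduel.le le_rfl
      have hle := hduel.le
      obtain ⟨-, -, v, -, -, hv, -⟩ := hwf.exists_solo_run hp
      obtain ⟨-, -, w, -, -, hw, -⟩ := hwf.exists_solo_run hq
      have hbal' : W v ↔ W w := by
        constructor
        · intro h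
          obtain ⟨w', h1, h2⟩ := hbal.1 ⟨v, hv, h⟩
          rwa [hw.unique h1]
        · intro h
          obtain ⟨v', h1, h2⟩ := hbal.2 ⟨w, hw, h⟩
          rwa [hv.unique h1]
      rcases hx : A.next p ((A.run d K).1 p).1 with y | v'
      swap
      -- If `p` were about to return, exactly one of `v` and `w` would satisfy `W`, contrary to
      -- balance.
      · obtain rfl := hv.unique (soloReturns_of_next hx)
        have := hduel.length_eq_iff hwf hpq hN hfit hx hw
        simp only [W] at hbal'
        tauto
      rcases hy : A.next q ((A.run d K).1 q).1 with z | w'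
      swap
      · obtain rfl := hw.unique (soloReturns_of_next hy)
        have := hduel.symm.length_eq_iff hwf hpq.symm hN hfit hy hv
        simp only [W] at hbal'
        tauto
      have hextend : ∀ (d : ℕ → A.Decision) (K : ℕ) (r : Fin n) (u : A.Access),
          Duel d₀ N p q x N (N + 1) d K → r = p ∨ r = q →
          A.next r ((A.run d K).1 r).1 = .inl u →
          ∃ d', (∀ k < K, d' k = d k) ∧ Duel d₀ N p q x N (N + 1) d' (K + 1) ∧
            A.run d' (K + 1) = (exec (A.run d K) (some (r, none))).1 := by
        intro d K r u hduel hr hu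
        let d' : ℕ → A.Decision := fun k => if k < K then d k else some (r, none)
        have hag : ∀ k < K, d k = d' k := fun k hk => (if_pos hk).symm
        have hdK : d' K = some (r, none) := if_neg (by omega)
        have hrun : A.run d' (K + 1) = (exec (A.run d K) (some (r, none))).1 := by
          rw [run, hdK, run_congr hag le_rfl]
        have hduel' := hduel.congr hag
        have hle := hduel.le
        obtain ⟨hp, hq⟩ := hduel.running K hle le_rfl
        have hrr : ((A.run d K).1 r).2 = true := by rcases hr with rfl | rfl <;> assumption
        refine ⟨d', fun k hk => (hag k hk).symm, ⟨by omega, hduel'.agree, hduel'.instants,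
          hduel'.call_left, hduel'.call_right, fun k h1 h2 => ?_, fun k h1 h2 => ?_⟩, hrun⟩
        · rcases Nat.lt_succ_iff_lt_or_eq.1 h2 with h | rfl
          · exact hduel'.steps k h1 h
          · rw [hdK]
            rcases hr with rfl | rfl
            · exact Or.inl rfl
            · exact Or.inr rfl
        · rcases Nat.le_succ_iff.1 h2 with h | rfl
          · exact hduel'.running k h1 h
          · rw [hrun, exec_access hrr hu]
            rcases hr with rfl | rfl
            · simp [hpq.symm, hq]
            · simp [hpq, hp]
      obtain ⟨d₁, ha₁, hd₁, hr₁⟩ := hextend d K p y hduel (Or.inl rfl) hx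
      obtain ⟨d₂, ha₂, hd₂, hr₂⟩ := hextend d K q z hduel (Or.inr rfl) hy
      have hy₁ : A.next q ((A.run d₁ (K + 1)).1 q).1 = .inl z := by
        rw [hr₁, exec_of_ne hpq.symm]; exact hy
      obtain ⟨d₃, ha₃, hd₃, hr₃⟩ := hextend d₁ (K + 1) q z hd₁ (Or.inr rfl) hy₁
      rcases hbal.step hpq hp hq hx hy with h | h | h
      · exact ⟨d₁, K + 1, by omega, ha₁, ⟨hd₁, by rw [hr₁]; exact h⟩, trivial⟩
      · exact ⟨d₂, K + 1, by omega, ha₂, ⟨hd₂, by rw [hr₂]; exact h⟩, trivial⟩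
      · exact ⟨d₃, K + 2, by omega, fun k hk => (ha₃ k (by omega)).trans (ha₁ k hk),
          ⟨hd₃, by rw [hr₃, hr₁]; exact h⟩, trivial⟩
  have hduel : ∀ k, Duel d₀ N p q x N (N + 1) d (L k) := fun k => (hd k).1.1
  have hLk : ∀ k, k ≤ L k := fun k => hL.le_apply
  have hrun : ∀ k, N + 2 ≤ k → ((A.run d k).1 p).2 = true ∧ ((A.run d k).1 q).2 = true :=
    fun k hk => (hduel k).running k hk (hLk k)
  -- From `N + 2` on only `p` and `q` are scheduled, so one of them takes infinitely many steps
  -- although its operation never ends.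
  by_cases hp : ∀ k, ∃ l, k ≤ l ∧ d l = some (p, none)
  · obtain ⟨k, hk, h⟩ := hwf.exists_not_running (N := N + 2) hp
    rw [(hrun k hk).1] at h
    simp at h
  · push Not at hp
    obtain ⟨k₀, hk₀⟩ := hp
    obtain ⟨k, hk, h⟩ := hwf.exists_not_running (d := d) (N := N + 2) (p := q) fun k =>
      ⟨max (max k k₀) (N + 2), by omega, by
        have h1 : N + 2 ≤ max (max k k₀) (N + 2) := le_max_right _ _
        have h2 : k₀ ≤ max (max k k₀) (N + 2) := by omega
        have h3 := hL.lt_iff_lt.2 (Nat.lt_succ_self (max (max k k₀) (N + 2)))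
        have h4 := hLk (max (max k k₀) (N + 2))
        exact ((hduel _).steps _ h1 (h4.trans_lt h3)).resolve_left (hk₀ _ h2)⟩
    rw [(hrun k hk).2] at h
    simp at h

end Implementation

theorem corollary12 (V : Type) [Primcodable V] [Nonempty V] (X : Type) [Primcodable X] :
    eventualConsensusNumber V (registerType X) = 1 := by
  refine le_antisymm (sSup_le ?_) (le_sSup ?_)
  · rintro _ ⟨n, ⟨A, hwf, hlin⟩, rfl⟩
    by_contra h
    have hn : 2 ≤ n := by
      by_contra h'
      exact h (Nat.cast_le_one.2 (by omega))
    exact Implementation.not_waitFree_of_isEventuallyLinearizable hn hlin hwf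
  · exact ⟨1, ⟨localFac (registerType X) V, localFac.waitFree,
      localFac.isEventuallyLinearizable⟩, by simp⟩
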